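/- Let $p,q,r>1$ be real numbers, let $p_*=p/(p-1)$ and $\theta=\frac1{p_*}+\frac1q$. For real $a<b$ consider, on the set $X_{a,b}$ of all functions $u\in C^1([a,b])$ that do not vanish identically and satisfy $$\int_a^b|u(x)|^{r-2}u(x)\,dx=0,$$ the Wirtinger quotient $$Q_{a,b}(u)=(b-a)^{\theta}\,\frac{\|u'\|_{L^p((a,b))}}{\|u\|_{L^q((a,b))}} .$$ A function $u\in X_{a,b}$ is called a local minimizer on $[a,b]$ if there is $\delta>0$ such that $Q_{a,b}(u)\le Q_{a,b}(v)$ for every $v\in X_{a,b}$ with $\|v-u\|_{C^1([a,b])}=\sup_{[a,b]}|v-u|+\sup_{[a,b]}|v'-u'|<\delta$. A function $u$ on $[a,b]$ is called odd if $u(a+b-x)=-u(x)$ for every $x\in[a,b]$. Assume that $q>(2r-1)p$. Then: 1. There are a unique $T>0$ and a unique function $u_W:[-T,T]\to[-1,1]$ such that $u_W'(x)=\left(1-|u_W(x)|^q\right)^{1/p}$ for every $x\in[-T,T]$, $u_W'(-T)=u_W'(T)=0$, and $u_W'(x)>0$ for every $x\in(-T,T)$. The function $u_W$ is odd and belongs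 to $X_{-T,T}$, but it is not a local minimizer on $[-T,T]$. 2. For all real $a<b$, no odd function $u:[a,b]\to\mathbb{R}$ is a local minimizer on $[a,b]$. -/

import Mathlib

open Set

noncomputable section

namespace Wirtinger

/-- The derivative of `u` on `[a, b]` (one-sided at the endpoints). -/
def der (a b : ℝ) (u : ℝ → ℝ) (x : ℝ) : ℝ := derivWithin u (Icc a b) x

/-- The norm of `u` in `L^s((a, b))`, for a continuous function `u` on `[a, b]`. -/
def lpNorm (a b s : ℝ) (u : ℝ → ℝ) : ℝ := (∫ x in a..b, |u x| ^ s) ^ (1 / s)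

/-- `θ = 1 / p_* + 1 / q`, where `p_*` is the exponent conjugate to `p`. -/
def theta (p q : ℝ) : ℝ := 1 / p.conjExponent + 1 / q

/-- The quotient `(b - a)^θ ‖u'‖_p / ‖u‖_q`. -/
def quotient (p q a b : ℝ) (u : ℝ → ℝ) : ℝ :=
  (b - a) ^ theta p q * (lpNorm a b p (der a b u) / lpNorm a b q u)

/-- The competitors on `[a, b]`: functions of class `C^1` on `[a, b]`, not identically zero there,
with `∫ |u|^(r-2) u = 0`. Only the values on `[a, b]` matter. -/
structure Admissible (r a b : ℝ) (u : ℝ → ℝ) : Prop where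
  contDiffOn : ContDiffOn ℝ 1 u (Icc a b)
  nontrivial : ∃ x ∈ Icc a b, u x ≠ 0
  integral_eq_zero : ∫ x in a..b, |u x| ^ (r - 2) * u x = 0

/-- The `C^1` norm on `[a, b]`: `sup |w| + sup |w'|`. -/
def c1Norm (a b : ℝ) (w : ℝ → ℝ) : ℝ :=
  sSup ((fun x => |w x|) '' Icc a b) + sSup ((fun x => |der a b w x|) '' Icc a b)

/-- `u` is a local minimizer, in the `C^1` norm, of the quotient among the competitors
on `[a, b]`. -/
def IsLocalMinimizer (p q r a b : ℝ) (u : ℝ → ℝ) : Prop :=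
  Admissible r a b u ∧ ∃ δ > 0, ∀ v : ℝ → ℝ, Admissible r a b v →
    c1Norm a b (fun x => v x - u x) < δ → quotient p q a b u ≤ quotient p q a b v

/-- `u` is odd on `[a, b]`, that is, odd with respect to the midpoint of `[a, b]`. -/
def IsOddOn (a b : ℝ) (u : ℝ → ℝ) : Prop :=
  ∀ x ∈ Icc a b, u (a + b - x) = -u x

/-- `u` is the solution on `[-T, T]` of `u' = (1 - |u|^q)^(1/p)` with `u'(-T) = u'(T) = 0` and
`u' > 0` in `(-T, T)`. The field `abs_le_one` says that the right-hand side is a power of a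
nonnegative number. -/
structure IsUW (p q T : ℝ) (u : ℝ → ℝ) : Prop where
  pos : 0 < T
  abs_le_one : ∀ x ∈ Icc (-T) T, |u x| ≤ 1
  hasDerivWithinAt : ∀ x ∈ Icc (-T) T,
    HasDerivWithinAt u ((1 - |u x| ^ q) ^ (1 / p)) (Icc (-T) T) x
  der_left : der (-T) T u (-T) = 0
  der_right : der (-T) T u T = 0
  der_pos : ∀ x ∈ Ioo (-T) T, 0 < der (-T) T u x

end Wirtinger

end

/-!
An odd local minimizer is unstable under a suitable even perturbation. Write
`S_s(y) = |y|^(s-2) y` (`spow`), `E = ∫ |u'|^p`, `N = ∫ |u|^q`, `κ = E / N`.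

**First variation.** Odd perturbations of an odd `u` satisfy the constraint automatically, so an odd
local minimizer is critical in all odd directions. This already gives the Euler-Lagrange
equation `(S_p(u'))' = -κ S_q(u)` without multiplier, with the Neumann condition
(`OddMin.euler_lagrange`), and the first integral `|u'|^p = ρ (1 - |u|^q)`,
`ρ = κ p / (q (p - 1))`, once `max |u| = 1` (`OddMin.exists_extremal`). No explicit solution is
needed, and `u` may oscillate any number of times.

**A profile.** The second variation is tested with even directions `ζ = f(u) + c`, where `f` is even
and solves `(1 - |y|^q) f' + (q/p) S_q(y) f = S_r(y)` on `[-1, 1]`. Among the solutions, which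
differ by multiples of `(1 - |y|^q)^(1/p)`, `f` is the one that is Lipschitz up to `±1`
(`exists_profile`). Then `M = f'(u) S_p(u')` solves the linearized equation
`M' = ρ (r - 1) |u|^(r-2) - κ (q - 1) / (p - 1) |u|^(q-2) f(u)`, and it vanishes at the endpoints.
Integrating `M'` and `(M f(u))'` expresses all terms of the second variation through
`K = ∫ |u|^(r-2) f(u)`, and for the constant `c` for which `ζ` is tangent to the constraint, the
second variation is negative as soon as `K < 0` (`Extremal.exists_negative_direction`).

**The threshold.** The derivative of `(S_r(u) f(u) - (p/q) S_{q/p+1}(u)) / u'` is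
`(r - 1) |u|^(r-2) f(u) + (|u|^(2r-2) - |u|^(q/p-1)) / (1 - |u|^q)`, and the quotient vanishes at
the endpoints. For `q > (2 r - 1) p` the last term is positive, so that `K < 0`
(`Extremal.integral_constraint_neg`).

**Second variation.** As `f'(u)` is bounded and `(f(u))' = f'(u) u'`, the difference quotients of
`∫ |u' + ε ζ'|^p` are controlled for every `p > 1`. Those of `∫ |u + ε ζ|^q` and of the constraint
are dominated by multiples of `|u|^(q-2) + 1` and `|u|^(r-2) + 1`, which are integrable because the
zeros of `u` are nondegenerate. The constraint is restored by adding to `ζ` constants that tend to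
`0` with `ε` (`Extremal.exists_correction`), and comparison of the logarithms of the ratios
contradicts minimality (`not_oddMin`).

The function `u_W` is the inverse of `y ↦ ∫_0^y (1 - |t|^q)^(-1/p) dt`; uniqueness is separation of
variables (`IsUW.eq_inverse`). It is odd, so that it falls under the previous argument.
-/

noncomputable section

namespace Wirtinger

open Filter Topology Asymptotics

/-! ### Signed powers -/

/-- The signed power `|y|^(s-2) y`, whose modulus is `|y|^(s-1)`. -/
def spow (s y : ℝ) : ℝ := |y| ^ (s - 2) * y

@[simp] lemma spow_zero (s : ℝ) : spow s 0 = 0 := by simp [spow]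

lemma spow_neg (s y : ℝ) : spow s (-y) = -spow s y := by simp [spow]

lemma spow_of_pos {s y : ℝ} (hy : 0 < y) : spow s y = y ^ (s - 1) := by
  rw [spow, abs_of_pos hy]
  nth_rewrite 2 [← Real.rpow_one y]
  rw [← Real.rpow_add hy]
  ring_nf

lemma spow_of_nonneg {s y : ℝ} (hs : 1 < s) (hy : 0 ≤ y) : spow s y = y ^ (s - 1) := by
  rcases hy.eq_or_lt with rfl | hy
  · rw [spow_zero, Real.zero_rpow (by linarith)]
  · exact spow_of_pos hy

lemma abs_spow {s : ℝ} (hs : 1 < s) (y : ℝ) : |spow s y| = |y| ^ (s - 1) := by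
  have h : |spow s y| = spow s |y| := by
    rw [spow, spow, abs_mul, abs_abs, abs_of_nonneg (Real.rpow_nonneg (abs_nonneg y) _)]
  rw [h, spow_of_nonneg hs (abs_nonneg y)]

lemma spow_mul (s x y : ℝ) : spow s (x * y) = spow s x * spow s y := by
  rw [spow, spow, spow, abs_mul, Real.mul_rpow (abs_nonneg _) (abs_nonneg _)]
  ring

lemma spow_one (s : ℝ) : spow s 1 = 1 := by simp [spow]

lemma abs_rpow_sub_two_mul_sq {s : ℝ} (hs : s ≠ 0) (y : ℝ) :
    |y| ^ (s - 2) * y ^ 2 = |y| ^ s := by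
  rcases eq_or_ne y 0 with rfl | hy
  · simp [Real.zero_rpow hs]
  · rw [← sq_abs y, ← Real.rpow_natCast, ← Real.rpow_add (abs_pos.2 hy)]
    norm_num

lemma spow_mul_self {s : ℝ} (hs : s ≠ 0) (y : ℝ) : spow s y * y = |y| ^ s := by
  rw [← abs_rpow_sub_two_mul_sq hs y, spow]
  ring

lemma spow_mul_spow {s t y : ℝ} (hs : 1 < s) (ht : 1 < t) :
    spow s y * spow t y = |y| ^ (s + t - 2) := by
  rcases eq_or_ne y 0 with rfl | hy
  · rw [spow_zero, zero_mul, abs_zero, Real.zero_rpow (by linarith)]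
  · have h : spow s y * spow t y = |y| ^ (s - 2) * |y| ^ (t - 2) * |y| ^ 2 := by
      rw [spow, spow, sq_abs]; ring
    rw [h, ← Real.rpow_natCast, ← Real.rpow_add (abs_pos.2 hy), ← Real.rpow_add (abs_pos.2 hy)]
    congr 1
    push_cast
    ring

/-- The signed powers of conjugate exponents are inverse to each other. -/
lemma spow_spow {s t : ℝ} (h : (s - 1) * (t - 1) = 1) (y : ℝ) : spow t (spow s y) = y := by
  have key : ∀ y : ℝ, 0 < y → spow t (spow s y) = y := fun y hy => by
    rw [spow_of_pos hy, spow_of_pos (Real.rpow_pos_of_pos hy _), ← Real.rpow_mul hy.le, h,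
      Real.rpow_one]
  rcases lt_trichotomy y 0 with hy | rfl | hy
  · have := key (-y) (by linarith)
    rw [spow_neg, spow_neg] at this
    linarith
  · simp
  · exact key y hy

lemma hasDerivAt_abs_rpow_spow {s : ℝ} (hs : 1 < s) (x : ℝ) :
    HasDerivAt (fun y : ℝ => |y| ^ s) (s * spow s x) x := by
  simpa only [spow, mul_assoc] using hasDerivAt_abs_rpow x hs

lemma hasDerivAt_spow (s : ℝ) {x : ℝ} (hx : x ≠ 0) :
    HasDerivAt (spow s) ((s - 1) * |x| ^ (s - 2)) x := by
  have key : ∀ x : ℝ, 0 < x → HasDerivAt (spow s) ((s - 1) * |x| ^ (s - 2)) x := fun x hx => by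
    have h := Real.hasDerivAt_rpow_const (x := x) (p := s - 1) (Or.inl hx.ne')
    rw [abs_of_pos hx]
    have e : s - 1 - 1 = s - 2 := by ring
    rw [e] at h
    refine h.congr_of_eventuallyEq ?_
    filter_upwards [lt_mem_nhds hx] with y hy using spow_of_pos hy
  rcases lt_or_gt_of_ne hx with hx | hx
  · have h := (key (-x) (by linarith)).scomp x (hasDerivAt_neg x)
    have e : (-spow s ∘ Neg.neg) = spow s := by
      funext y
      simp [spow_neg]
    have h2 := h.neg
    rw [abs_neg, e] at h2
    exact h2.congr_deriv (by simp)
  · exact key x hx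

lemma continuous_spow {s : ℝ} (hs : 1 < s) : Continuous (spow s) := by
  rw [continuous_iff_continuousAt]
  intro x
  rcases eq_or_ne x 0 with rfl | hx
  · rw [ContinuousAt, spow_zero, tendsto_zero_iff_abs_tendsto_zero]
    have h : Tendsto (fun y : ℝ => |y| ^ (s - 1)) (𝓝 0) (𝓝 0) := by
      have : Continuous fun y : ℝ => |y| ^ (s - 1) :=
        continuous_abs.rpow_const fun _ => Or.inr (by linarith)
      simpa [Real.zero_rpow (by linarith : s - 1 ≠ 0)] using this.tendsto 0
    exact h.congr fun y => (abs_spow hs y).symm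
  · exact (hasDerivAt_spow s hx).continuousAt

lemma strictMono_spow {s : ℝ} (hs : 1 < s) : StrictMono (spow s) := by
  refine strictMono_of_odd_strictMonoOn_nonneg (spow_neg s) ?_
  intro x hx y hy hxy
  rw [spow_of_nonneg hs hx, spow_of_nonneg hs hy]
  exact Real.rpow_lt_rpow hx hxy (by linarith)

/-! ### Finite differences of powers -/

/-- For `|t|` at least comparable to `|a|`, a power of `|t|` is controlled by the same power of
`|a|` if the exponent is negative, and by `1` otherwise. -/
lemma abs_rpow_le_of_mul_le {c : ℝ} (hc : 0 < c) (e : ℝ) :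
    ∃ C, 0 ≤ C ∧ ∀ a t : ℝ, a ≠ 0 → c * |a| ≤ |t| → |t| ≤ 1 → |t| ^ e ≤ C * (|a| ^ e + 1) := by
  have h0 : 0 < c ^ e := Real.rpow_pos_of_pos hc e
  refine ⟨1 + c ^ e, by linarith, fun a t ha hat ht => ?_⟩
  have ha' : 0 < |a| := abs_pos.2 ha
  have h1 : 0 < |a| ^ e := Real.rpow_pos_of_pos ha' e
  rcases le_or_gt 0 e with he | he
  · have : |t| ^ e ≤ 1 := Real.rpow_le_one (abs_nonneg t) ht he
    nlinarith
  · have : |t| ^ e ≤ (c * |a|) ^ e :=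
      Real.rpow_le_rpow_of_nonpos (mul_pos hc ha') hat he.le
    rw [Real.mul_rpow hc.le ha'.le] at this
    nlinarith

/-- A bound on first differences of the signed power. It is uniform in `a`, with the singular factor
`|a|^(r-2)` of the derivative: for `|t|` small relative to `|a|` it follows by scaling from the
derivative at `1`, otherwise from the size of both terms. -/
lemma abs_spow_add_sub_le {r : ℝ} (hr : 1 < r) :
    ∃ C, 0 ≤ C ∧ ∀ a t : ℝ, a ≠ 0 → |t| ≤ 1 →
      |spow r (a + t) - spow r a| ≤ C * |t| * (|a| ^ (r - 2) + 1) := by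
  have hd : (fun x => spow r x - spow r 1) =O[𝓝 1] fun x => x - 1 :=
    (hasDerivAt_spow r one_ne_zero).isBigO_sub
  obtain ⟨c, hc, hO⟩ := hd.exists_pos
  obtain ⟨d, hd0, hd⟩ := Metric.eventually_nhds_iff.1 hO.bound
  obtain ⟨C1, hC1, hC1'⟩ := abs_rpow_le_of_mul_le hd0 (r - 2)
  have hk : 0 ≤ (1 / d + 1) ^ (r - 1) := Real.rpow_nonneg (by positivity) _
  refine ⟨c + 2 * (1 / d + 1) ^ (r - 1) * C1, by positivity, fun a t ha ht => ?_⟩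
  have ha' : 0 < |a| := abs_pos.2 ha
  have h1 : 0 < |a| ^ (r - 2) := Real.rpow_pos_of_pos ha' _
  rcases lt_or_ge |t| (d * |a|) with h | h
  · have e1 : a + t = a * (1 + t / a) := by field_simp
    have e2 : spow r (a + t) - spow r a = spow r a * (spow r (1 + t / a) - spow r 1) := by
      rw [e1, spow_mul, spow_one]; ring
    have h2 := hd (y := 1 + t / a) (by
      rw [Real.dist_eq, add_sub_cancel_left, abs_div, div_lt_iff₀ ha']; exact h)
    rw [Real.norm_eq_abs, Real.norm_eq_abs, add_sub_cancel_left, abs_div] at h2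
    have e3 : |spow r a| = |a| ^ (r - 2) * |a| := by
      rw [spow, abs_mul, abs_of_pos h1]
    rw [e2, abs_mul, e3]
    calc |a| ^ (r - 2) * |a| * |spow r (1 + t / a) - spow r 1|
        ≤ |a| ^ (r - 2) * |a| * (c * (|t| / |a|)) := by gcongr
      _ = c * |t| * |a| ^ (r - 2) := by field_simp
      _ ≤ _ := by
        gcongr
        · exact le_add_of_nonneg_right (by positivity)
        · linarith
  · have ht0 : 0 < |t| := lt_of_lt_of_le (by positivity) h
    have ha2 : |a| ≤ 1 / d * |t| := by
      rw [div_mul_eq_mul_div, one_mul, le_div_iff₀ hd0]; linarith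
    have b1 : |spow r (a + t)| ≤ ((1 / d + 1) * |t|) ^ (r - 1) := by
      rw [abs_spow hr]
      refine Real.rpow_le_rpow (abs_nonneg _) ?_ (by linarith)
      linarith [abs_add_le a t]
    have b2 : |spow r a| ≤ ((1 / d + 1) * |t|) ^ (r - 1) := by
      rw [abs_spow hr]
      exact Real.rpow_le_rpow (abs_nonneg _) (by linarith) (by linarith)
    have e1 : ((1 / d + 1) * |t|) ^ (r - 1) = (1 / d + 1) ^ (r - 1) * (|t| ^ (r - 2) * |t|) := by
      rw [Real.mul_rpow (by positivity) ht0.le]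
      congr 1
      nth_rewrite 3 [← Real.rpow_one |t|]
      rw [← Real.rpow_add ht0]
      ring_nf
    have b3 := hC1' a t ha h ht
    calc |spow r (a + t) - spow r a| ≤ |spow r (a + t)| + |spow r a| := abs_sub _ _
      _ ≤ 2 * ((1 / d + 1) ^ (r - 1) * (|t| ^ (r - 2) * |t|)) := by rw [← e1]; linarith
      _ ≤ 2 * ((1 / d + 1) ^ (r - 1) * (C1 * (|a| ^ (r - 2) + 1) * |t|)) := by gcongr
      _ = 2 * (1 / d + 1) ^ (r - 1) * C1 * |t| * (|a| ^ (r - 2) + 1) := by ring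
      _ ≤ _ := by
        gcongr
        exact le_add_of_nonneg_left hc.le

/-- The symmetric second difference of `|·|^q`. -/
def secondDiff (q a t : ℝ) : ℝ := |a + t| ^ q + |a - t| ^ q - 2 * |a| ^ q

lemma secondDiff_mul (q a s : ℝ) : secondDiff q a (a * s) = |a| ^ q * secondDiff q 1 s := by
  have e1 : a + a * s = a * (1 + s) := by ring
  have e2 : a - a * s = a * (1 - s) := by ring
  rw [secondDiff, secondDiff, e1, e2, abs_mul, abs_mul, Real.mul_rpow (abs_nonneg _) (abs_nonneg _),
    Real.mul_rpow (abs_nonneg _) (abs_nonneg _), abs_one, Real.one_rpow]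
  ring

lemma continuous_secondDiff {q : ℝ} (hq : 0 ≤ q) :
    Continuous fun z : ℝ × ℝ => secondDiff q z.1 z.2 := by
  have h : Continuous fun y : ℝ => |y| ^ q := continuous_abs.rpow_const fun _ => Or.inr hq
  exact ((h.comp (continuous_fst.add continuous_snd)).add
    (h.comp (continuous_fst.sub continuous_snd))).sub (continuous_const.mul (h.comp continuous_fst))

lemma secondDiff_sub_isLittleO {q : ℝ} (hq : 1 < q) {a : ℝ} (ha : a ≠ 0) :
    (fun t => secondDiff q a t - q * (q - 1) * |a| ^ (q - 2) * t ^ 2) =o[𝓝 0] fun t => t ^ 2 := by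
  set c := q * (q - 1) * |a| ^ (q - 2) with hc
  set h : ℝ → ℝ := fun t => secondDiff q a t - c * t ^ 2 with hh
  set h' : ℝ → ℝ := fun t => q * spow q (a + t) - q * spow q (a - t) - 2 * c * t with hh'
  have hd : ∀ t, HasDerivAt h (h' t) t := fun t => by
    have d1 := (hasDerivAt_abs_rpow_spow hq (a + t)).comp t ((hasDerivAt_id t).const_add a)
    have d2 := (hasDerivAt_abs_rpow_spow hq (a - t)).comp t ((hasDerivAt_id t).const_sub a)
    have d3 := ((hasDerivAt_pow 2 t).const_mul c)
    refine (((d1.add d2).sub_const (2 * |a| ^ q)).sub d3).congr_deriv ?_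
    simp only [hh']
    norm_num
    ring
  have hd0 : HasDerivAt h' 0 0 := by
    have e1 : HasDerivAt (fun t => spow q (a + t)) ((q - 1) * |a| ^ (q - 2)) 0 := by
      have := HasDerivAt.comp_const_add a 0 (by simpa using hasDerivAt_spow q ha)
      simpa using this
    have e2 : HasDerivAt (fun t => spow q (a - t)) (-((q - 1) * |a| ^ (q - 2))) 0 := by
      have := HasDerivAt.comp_const_sub a 0 (by simpa using hasDerivAt_spow q ha)
      simpa using this
    have e3 := ((e1.const_mul q).sub (e2.const_mul q)).sub
      ((hasDerivAt_id (0 : ℝ)).const_mul (2 * c))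
    refine e3.congr_deriv ?_
    rw [hc]; ring
  have h'0 : h' 0 = 0 := by simp [hh']
  have h0 : h 0 = 0 := by simp [hh, secondDiff]; ring
  have ho : h' =o[𝓝 0] fun t => t := by
    have := hd0.isLittleO
    simpa [h'0] using this
  rw [isLittleO_iff]
  intro ε hε
  obtain ⟨d, hd0, hd1⟩ := Metric.eventually_nhds_iff.1 ((isLittleO_iff.1 ho) hε)
  refine Metric.eventually_nhds_iff.2 ⟨d, hd0, fun t ht => ?_⟩
  rw [dist_zero_right] at ht
  have hb : ∀ x ∈ Metric.closedBall (0 : ℝ) |t|, ‖h' x‖ ≤ ε * |t| := fun x hx => by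
    rw [mem_closedBall_zero_iff] at hx
    refine (hd1 (by rw [dist_zero_right]; exact lt_of_le_of_lt hx ht)).trans ?_
    gcongr
  have := (convex_closedBall (0 : ℝ) |t|).norm_image_sub_le_of_norm_hasDerivWithin_le
    (fun x _ => (hd x).hasDerivWithinAt) hb (Metric.mem_closedBall_self (abs_nonneg t))
    (y := t) (by simp)
  rw [h0, sub_zero, sub_zero] at this
  refine this.trans (le_of_eq ?_)
  rw [Real.norm_eq_abs, Real.norm_eq_abs, abs_pow, mul_assoc, sq]

/-- The analogue of `abs_spow_add_sub_le` for symmetric second differences of `|·|^q`. -/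
lemma abs_secondDiff_le {q : ℝ} (hq : 1 < q) :
    ∃ C, 0 ≤ C ∧ ∀ a t : ℝ, a ≠ 0 → |t| ≤ 1 →
      |secondDiff q a t| ≤ C * t ^ 2 * (|a| ^ (q - 2) + 1) := by
  have hO : (fun t => secondDiff q 1 t) =O[𝓝 0] fun t => t ^ 2 := by
    have h1 := (secondDiff_sub_isLittleO hq one_ne_zero).isBigO
    have h2 : (fun t : ℝ => q * (q - 1) * |(1 : ℝ)| ^ (q - 2) * t ^ 2) =O[𝓝 0] fun t => t ^ 2 :=
      isBigO_const_mul_self _ _ _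
    simpa using h1.add h2
  obtain ⟨c, hc, hO⟩ := hO.exists_pos
  obtain ⟨d, hd0, hd⟩ := Metric.eventually_nhds_iff.1 hO.bound
  obtain ⟨C1, hC1, hC1'⟩ := abs_rpow_le_of_mul_le hd0 (q - 2)
  have hk : 0 ≤ (1 / d + 1) ^ q := Real.rpow_nonneg (by positivity) _
  refine ⟨c + 4 * (1 / d + 1) ^ q * C1, by positivity, fun a t ha ht => ?_⟩
  have ha' : 0 < |a| := abs_pos.2 ha
  have h1 : 0 < |a| ^ (q - 2) := Real.rpow_pos_of_pos ha' _
  rcases lt_or_ge |t| (d * |a|) with h | h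
  · have e1 : t = a * (t / a) := by field_simp
    have h2 := hd (y := t / a) (by
      rw [dist_zero_right, Real.norm_eq_abs, abs_div, div_lt_iff₀ ha']; exact h)
    rw [Real.norm_eq_abs, Real.norm_eq_abs, abs_pow, sq_abs, div_pow] at h2
    have e2 : |secondDiff q a t| = |a| ^ q * |secondDiff q 1 (t / a)| := by
      nth_rewrite 1 [e1]
      rw [secondDiff_mul, abs_mul, abs_of_nonneg (Real.rpow_nonneg ha'.le _)]
    rw [e2, ← abs_rpow_sub_two_mul_sq (by linarith : q ≠ 0) a]
    calc |a| ^ (q - 2) * a ^ 2 * |secondDiff q 1 (t / a)|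
        ≤ |a| ^ (q - 2) * a ^ 2 * (c * (t ^ 2 / a ^ 2)) := by gcongr
      _ = c * t ^ 2 * |a| ^ (q - 2) := by field_simp
      _ ≤ _ := by
        gcongr
        · exact le_add_of_nonneg_right (by positivity)
        · linarith
  · have ht0 : 0 < |t| := lt_of_lt_of_le (by positivity) h
    have ha2 : |a| ≤ 1 / d * |t| := by
      rw [div_mul_eq_mul_div, one_mul, le_div_iff₀ hd0]; linarith
    have b : ∀ x, |x| ≤ |a| + |t| → |x| ^ q ≤ ((1 / d + 1) * |t|) ^ q := fun x hx =>
      Real.rpow_le_rpow (abs_nonneg _) (by linarith) (by linarith)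
    have b1 := b (a + t) (abs_add_le a t)
    have b2 := b (a - t) (abs_sub a t)
    have b3 := b a (by linarith)
    have e1 : ((1 / d + 1) * |t|) ^ q = (1 / d + 1) ^ q * (|t| ^ (q - 2) * t ^ 2) := by
      rw [Real.mul_rpow (by positivity) ht0.le, abs_rpow_sub_two_mul_sq (by linarith)]
    have b4 := hC1' a t ha h ht
    have n1 := Real.rpow_nonneg (abs_nonneg (a + t)) q
    have n2 := Real.rpow_nonneg (abs_nonneg (a - t)) q
    have n3 := Real.rpow_nonneg (abs_nonneg a) q
    calc |secondDiff q a t| ≤ 4 * ((1 / d + 1) ^ q * (|t| ^ (q - 2) * t ^ 2)) := by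
          rw [← e1, secondDiff, abs_le]; constructor <;> linarith
      _ ≤ 4 * ((1 / d + 1) ^ q * (C1 * (|a| ^ (q - 2) + 1) * t ^ 2)) := by gcongr
      _ = 4 * (1 / d + 1) ^ q * C1 * t ^ 2 * (|a| ^ (q - 2) + 1) := by ring
      _ ≤ _ := by
        gcongr
        exact le_add_of_nonneg_left hc.le

/-! ### Functions of class `C^1` on an interval -/

/-- `u` is of class `C^1` on `[a, b]` with derivative `u'`; no condition outside `[a, b]`. -/
structure C1On (a b : ℝ) (u u' : ℝ → ℝ) : Prop where
  continuousOn_deriv : ContinuousOn u' (Icc a b)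
  hasDerivWithinAt : ∀ x ∈ Icc a b, HasDerivWithinAt u (u' x) (Icc a b) x

namespace C1On

variable {a b : ℝ} {u u' v v' : ℝ → ℝ}

lemma continuousOn (h : C1On a b u u') : ContinuousOn u (Icc a b) :=
  fun x hx => (h.hasDerivWithinAt x hx).continuousWithinAt

lemma hasDerivAt (h : C1On a b u u') {x : ℝ} (hx : x ∈ Ioo a b) : HasDerivAt u (u' x) x :=
  (h.hasDerivWithinAt x (Ioo_subset_Icc_self hx)).hasDerivAt (Icc_mem_nhds hx.1 hx.2)

lemma const (a b c : ℝ) : C1On a b (fun _ => c) (fun _ => 0) :=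
  ⟨continuousOn_const, fun x _ => hasDerivWithinAt_const x _ c⟩

lemma add (h : C1On a b u u') (k : C1On a b v v') :
    C1On a b (fun x => u x + v x) (fun x => u' x + v' x) :=
  ⟨h.1.add k.1, fun x hx => (h.2 x hx).add (k.2 x hx)⟩

lemma const_mul (h : C1On a b u u') (c : ℝ) :
    C1On a b (fun x => c * u x) (fun x => c * u' x) :=
  ⟨continuousOn_const.mul h.1, fun x hx => (h.2 x hx).const_mul c⟩

lemma mul (h : C1On a b u u') (k : C1On a b v v') :
    C1On a b (fun x => u x * v x) (fun x => u' x * v x + u x * v' x) :=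
  ⟨(h.1.mul k.continuousOn).add (h.continuousOn.mul k.1), fun x hx => (h.2 x hx).mul (k.2 x hx)⟩

lemma integral_deriv (h : C1On a b u u') (hab : a ≤ b) : ∫ x in a..b, u' x = u b - u a :=
  intervalIntegral.integral_eq_sub_of_hasDerivAt_of_le hab h.continuousOn
    (fun _ hx => h.hasDerivAt hx) (h.1.intervalIntegrable_of_Icc hab)

lemma der_eq (h : C1On a b u u') (hab : a < b) {x : ℝ} (hx : x ∈ Icc a b) :
    der a b u x = u' x :=
  (h.2 x hx).derivWithin (uniqueDiffOn_Icc hab x hx)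

lemma contDiffOn (h : C1On a b u u') (hab : a < b) : ContDiffOn ℝ 1 u (Icc a b) := by
  rw [contDiffOn_one_iff_derivWithin (uniqueDiffOn_Icc hab)]
  exact ⟨fun x hx => (h.2 x hx).differentiableWithinAt,
    h.1.congr fun x hx => h.der_eq hab hx⟩

lemma of_contDiffOn (hab : a < b) (h : ContDiffOn ℝ 1 u (Icc a b)) :
    C1On a b u (der a b u) := by
  rw [contDiffOn_one_iff_derivWithin (uniqueDiffOn_Icc hab)] at h
  exact ⟨h.2, fun x hx => (h.1 x hx).hasDerivWithinAt⟩

lemma primitive {c : ℝ} (hc : c ∈ Icc a b) (h : ContinuousOn u (Icc a b)) :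
    C1On a b (fun x => ∫ t in c..x, u t) u := by
  have hab : a ≤ b := hc.1.trans hc.2
  refine ⟨h, fun x hx => ?_⟩
  have hU : Continuous (IccExtend hab ((Icc a b).domRestrict u)) :=
    (continuousOn_iff_continuous_domRestrict.1 h).Icc_extend'
  have heq : ∀ y ∈ Icc a b, IccExtend hab ((Icc a b).domRestrict u) y = u y := fun y hy => by
    rw [IccExtend_of_mem _ _ hy]; rfl
  have hd := (intervalIntegral.integral_hasDerivAt_right (hU.intervalIntegrable c x)
    hU.stronglyMeasurable.stronglyMeasurableAtFilter hU.continuousAt).hasDerivWithinAt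
      (s := Icc a b)
  rw [heq x hx] at hd
  have hint : ∀ y ∈ Icc a b, ∫ t in c..y, u t =
      ∫ t in c..y, IccExtend hab ((Icc a b).domRestrict u) t := fun y hy =>
    intervalIntegral.integral_congr fun t ht =>
      (heq t (uIcc_subset_Icc hc hy ht)).symm
  exact hd.congr hint (hint x hx)

end C1On

/-! ### Reflection in the midpoint -/

lemma reflect_mem {a b x : ℝ} (hx : x ∈ Icc a b) : a + b - x ∈ Icc a b :=
  ⟨by linarith [hx.2], by linarith [hx.1]⟩

lemma integral_reflect (a b : ℝ) (f : ℝ → ℝ) :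
    ∫ x in a..b, f (a + b - x) = ∫ x in a..b, f x := by
  rw [intervalIntegral.integral_comp_sub_left]
  simp

lemma integral_eq_zero_of_odd {a b : ℝ} (hab : a ≤ b) {f : ℝ → ℝ}
    (h : ∀ x ∈ Icc a b, f (a + b - x) = -f x) : ∫ x in a..b, f x = 0 := by
  have h1 := integral_reflect a b f
  have h2 : ∫ x in a..b, f (a + b - x) = ∫ x in a..b, -f x :=
    intervalIntegral.integral_congr fun x hx => h x (by rwa [uIcc_of_le hab] at hx)
  rw [h2, intervalIntegral.integral_neg] at h1
  linarith

/-- The derivative of an odd function is even, and vice versa. -/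
lemma C1On.deriv_reflect {a b σ : ℝ} {u u' : ℝ → ℝ} (h : C1On a b u u') (hab : a < b)
    (hu : ∀ x ∈ Icc a b, u (a + b - x) = σ * u x) {x : ℝ} (hx : x ∈ Icc a b) :
    u' (a + b - x) = -σ * u' x := by
  have h1 : HasDerivWithinAt (fun y => u (a + b - y)) (u' (a + b - x) * (-1)) (Icc a b) x :=
    (h.2 _ (reflect_mem hx)).comp x ((hasDerivWithinAt_id x _).const_sub (a + b))
      fun y hy => reflect_mem hy
  have h2 : HasDerivWithinAt (fun y => u (a + b - y)) (σ * u' x) (Icc a b) x :=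
    ((h.2 x hx).const_mul σ).congr hu (hu x hx)
  have := (uniqueDiffOn_Icc hab x hx).eq_deriv _ h1 h2
  linarith

/-! ### Odd local minimizers -/

/-- The part `‖u'‖_p / ‖u‖_q` of the quotient, with the derivative as a separate argument. -/
def ratio (p q a b : ℝ) (u u' : ℝ → ℝ) : ℝ :=
  (∫ x in a..b, |u' x| ^ p) ^ (1 / p) / (∫ x in a..b, |u x| ^ q) ^ (1 / q)

/-- `u`, with derivative `u'`, is an odd local minimizer on `[a, b]`. Competitors are written as
`u + w` with `w` and `w'` uniformly small. -/
structure OddMin (p q r a b : ℝ) (u u' : ℝ → ℝ) : Prop where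
  lt : a < b
  c1On : C1On a b u u'
  odd : ∀ x ∈ Icc a b, u (a + b - x) = -u x
  nontrivial : ∃ x ∈ Icc a b, u x ≠ 0
  isMin : ∃ δ > 0, ∀ w w' : ℝ → ℝ, C1On a b w w' → (∀ x ∈ Icc a b, |w x| ≤ δ) →
    (∀ x ∈ Icc a b, |w' x| ≤ δ) → ∫ x in a..b, spow r (u x + w x) = 0 →
    ratio p q a b u u' ≤ ratio p q a b (fun x => u x + w x) (fun x => u' x + w' x)

lemma quotient_eq {p q a b : ℝ} {u u' : ℝ → ℝ} (hab : a < b) (h : C1On a b u u') :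
    quotient p q a b u = (b - a) ^ theta p q * ratio p q a b u u' := by
  have : ∫ x in a..b, |der a b u x| ^ p = ∫ x in a..b, |u' x| ^ p :=
    intervalIntegral.integral_congr fun x hx => by
      rw [uIcc_of_le hab.le] at hx
      simp only [h.der_eq hab hx]
  rw [quotient, lpNorm, lpNorm, this, ratio]

lemma c1Norm_le {a b α β : ℝ} {w w' : ℝ → ℝ} (hab : a < b) (h : C1On a b w w')
    (hw : ∀ x ∈ Icc a b, |w x| ≤ α) (hw' : ∀ x ∈ Icc a b, |w' x| ≤ β) :
    c1Norm a b w ≤ α + β := by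
  have hne : (Icc a b).Nonempty := nonempty_Icc.2 hab.le
  refine add_le_add (csSup_le (hne.image _) ?_) (csSup_le (hne.image _) ?_)
  · rintro _ ⟨x, hx, rfl⟩
    exact hw x hx
  · rintro _ ⟨x, hx, rfl⟩
    simp only [h.der_eq hab hx]
    exact hw' x hx

lemma OddMin.of_isLocalMinimizer {p q r a b : ℝ} {u : ℝ → ℝ} (hab : a < b)
    (hodd : IsOddOn a b u) (h : IsLocalMinimizer p q r a b u) :
    OddMin p q r a b u (der a b u) := by
  obtain ⟨hadm, δ, hδ, hmin⟩ := h
  have hu := C1On.of_contDiffOn hab hadm.contDiffOn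
  obtain ⟨x₀, hx₀, hne⟩ := hadm.nontrivial
  refine ⟨hab, hu, hodd, ⟨x₀, hx₀, hne⟩, min (δ / 3) (|u x₀| / 2),
    lt_min (by linarith) (by have := abs_pos.2 hne; linarith), ?_⟩
  intro w w' hw hwδ hwδ' hint
  have hv := hu.add hw
  have hvadm : Admissible r a b (fun x => u x + w x) := by
    refine ⟨hv.contDiffOn hab, ⟨x₀, hx₀, fun h0 => ?_⟩, hint⟩
    have h1 := (hwδ x₀ hx₀).trans (min_le_right _ _)
    have h2 : |w x₀| = |u x₀| := by
      rw [show w x₀ = -u x₀ by linarith, abs_neg]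
    have := abs_pos.2 hne
    linarith
  have hn : c1Norm a b (fun x => u x + w x - u x) < δ := by
    have e : (fun x => u x + w x - u x) = w := by funext x; ring
    rw [e]
    refine (c1Norm_le hab hw (fun x hx => (hwδ x hx).trans (min_le_left _ _))
      (fun x hx => (hwδ' x hx).trans (min_le_left _ _))).trans_lt ?_
    linarith
  have := hmin _ hvadm hn
  rw [quotient_eq hab hu, quotient_eq hab hv] at this
  exact le_of_mul_le_mul_left this (Real.rpow_pos_of_pos (by linarith) _)

lemma ratio_const_mul {p q a b c : ℝ} (hp : 1 < p) (hq : 1 < q) (hab : a ≤ b) (hc : 0 < c)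
    (u u' : ℝ → ℝ) :
    ratio p q a b (fun x => c * u x) (fun x => c * u' x) = ratio p q a b u u' := by
  have key : ∀ (s : ℝ) (f : ℝ → ℝ), 1 < s →
      (∫ x in a..b, |c * f x| ^ s) ^ (1 / s) = c * (∫ x in a..b, |f x| ^ s) ^ (1 / s) := by
    intro s f hs
    have e : ∀ x, |c * f x| ^ s = c ^ s * |f x| ^ s := fun x => by
      rw [abs_mul, abs_of_pos hc, Real.mul_rpow hc.le (abs_nonneg _)]
    simp only [e]
    rw [intervalIntegral.integral_const_mul, Real.mul_rpow (Real.rpow_nonneg hc.le _)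
      (intervalIntegral.integral_nonneg hab fun x _ => Real.rpow_nonneg (abs_nonneg _) _),
      ← Real.rpow_mul hc.le, mul_one_div_cancel (by linarith), Real.rpow_one]
  rw [ratio, ratio, key p u' hp, key q u hq, mul_div_mul_left _ _ hc.ne']

lemma OddMin.const_mul {p q r a b : ℝ} {u u' : ℝ → ℝ} (hp : 1 < p) (hq : 1 < q)
    (h : OddMin p q r a b u u') {c : ℝ} (hc : 0 < c) :
    OddMin p q r a b (fun x => c * u x) (fun x => c * u' x) := by
  obtain ⟨hab, hu, hodd, ⟨x₀, hx₀, hne⟩, δ, hδ, hmin⟩ := h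
  refine ⟨hab, hu.const_mul c, fun x hx => by rw [hodd x hx]; ring,
    ⟨x₀, hx₀, mul_ne_zero hc.ne' hne⟩, c * δ, by positivity, ?_⟩
  intro w w' hw hwδ hwδ' hint
  have hb : ∀ y, |y| ≤ c * δ → |c⁻¹ * y| ≤ δ := fun y hy => by
    rw [abs_mul, abs_of_pos (inv_pos.2 hc), inv_mul_le_iff₀ hc]
    exact hy
  have e1 : (fun x => c * u x + w x) = fun x => c * (u x + c⁻¹ * w x) := by
    funext x; field_simp
  have e2 : (fun x => c * u' x + w' x) = fun x => c * (u' x + c⁻¹ * w' x) := by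
    funext x; field_simp
  have e3 : ∀ x, c * u x + w x = c * (u x + c⁻¹ * w x) := fun x => congrFun e1 x
  rw [e1, e2, ratio_const_mul hp hq hab.le hc, ratio_const_mul hp hq hab.le hc]
  refine hmin _ _ (hw.const_mul c⁻¹) (fun x hx => hb _ (hwδ x hx))
    (fun x hx => hb _ (hwδ' x hx)) ?_
  simp only [e3, spow_mul] at hint
  rw [intervalIntegral.integral_const_mul] at hint
  refine (mul_eq_zero.1 hint).resolve_left ?_
  rw [spow_of_pos hc]
  exact (Real.rpow_pos_of_pos hc _).ne'

lemma OddMin.deriv_even {p q r a b : ℝ} {u u' : ℝ → ℝ} (h : OddMin p q r a b u u') :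
    ∀ x ∈ Icc a b, u' (a + b - x) = u' x := fun x hx => by
  have := h.c1On.deriv_reflect (σ := -1) h.lt (fun y hy => by rw [h.odd y hy]; ring) hx
  linarith

lemma integral_abs_rpow_pos {a b s : ℝ} (hab : a < b) (hs : 1 < s) {f : ℝ → ℝ}
    (hf : ContinuousOn f (Icc a b)) (hne : ∃ x ∈ Icc a b, f x ≠ 0) :
    0 < ∫ x in a..b, |f x| ^ s := by
  obtain ⟨x₀, hx₀, hne⟩ := hne
  exact intervalIntegral.integral_pos hab
    (hf.abs.rpow_const fun _ _ => Or.inr (by linarith))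
    (fun x _ => Real.rpow_nonneg (abs_nonneg _) _)
    ⟨x₀, hx₀, Real.rpow_pos_of_pos (abs_pos.2 hne) _⟩

lemma OddMin.norm_pos {p q r a b : ℝ} {u u' : ℝ → ℝ} (hq : 1 < q) (h : OddMin p q r a b u u') :
    0 < ∫ x in a..b, |u x| ^ q :=
  integral_abs_rpow_pos h.lt hq h.c1On.continuousOn h.nontrivial

lemma OddMin.energy_pos {p q r a b : ℝ} {u u' : ℝ → ℝ} (hp : 1 < p)
    (h : OddMin p q r a b u u') : 0 < ∫ x in a..b, |u' x| ^ p := by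
  refine integral_abs_rpow_pos h.lt hp h.c1On.continuousOn_deriv ?_
  by_contra! h0
  obtain ⟨x₀, hx₀, hne⟩ := h.nontrivial
  have hc : ∀ x ∈ Icc a b, u x = u a := by
    refine constant_of_has_deriv_right_zero h.c1On.continuousOn fun x hx => ?_
    have := h.c1On.hasDerivWithinAt x (Ico_subset_Icc_self hx)
    rw [h0 x (Ico_subset_Icc_self hx)] at this
    exact (this.mono (Icc_subset_Icc_left hx.1)).mono_of_mem_nhdsWithin
      (Icc_mem_nhdsGE hx.2)
  have := h.odd x₀ hx₀
  rw [hc _ hx₀, hc _ (reflect_mem hx₀)] at this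
  rw [hc _ hx₀] at hne
  exact hne (by linarith)

/-- Comparing two ratios amounts to comparing their logarithms. -/
lemma ratio_le_ratio_iff {E N E' N' p q : ℝ} (hE : 0 < E) (hN : 0 < N) (hE' : 0 < E')
    (hN' : 0 < N') : E ^ (1 / p) / N ^ (1 / q) ≤ E' ^ (1 / p) / N' ^ (1 / q) ↔
      1 / p * Real.log E - 1 / q * Real.log N ≤ 1 / p * Real.log E' - 1 / q * Real.log N' := by
  have hlog : ∀ {E N : ℝ}, 0 < E → 0 < N → Real.log (E ^ (1 / p) / N ^ (1 / q)) =
      1 / p * Real.log E - 1 / q * Real.log N := fun hE hN => by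
    rw [Real.log_div (Real.rpow_pos_of_pos hE _).ne' (Real.rpow_pos_of_pos hN _).ne',
      Real.log_rpow hE, Real.log_rpow hN]
  rw [← hlog hE hN, ← hlog hE' hN', Real.log_le_log_iff]
  · exact div_pos (Real.rpow_pos_of_pos hE _) (Real.rpow_pos_of_pos hN _)
  · exact div_pos (Real.rpow_pos_of_pos hE' _) (Real.rpow_pos_of_pos hN' _)

/-! ### The Euler-Lagrange equation -/

lemma hasDerivAt_integral_abs_rpow {a b s : ℝ} (hab : a ≤ b) (hs : 1 < s) {f g : ℝ → ℝ}
    (hf : ContinuousOn f (Icc a b)) (hg : ContinuousOn g (Icc a b)) :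
    HasDerivAt (fun ε => ∫ x in a..b, |f x + ε * g x| ^ s)
      (s * ∫ x in a..b, spow s (f x) * g x) 0 := by
  have hmeas : ∀ k : ℝ → ℝ, ContinuousOn k (Icc a b) →
      MeasureTheory.AEStronglyMeasurable k (MeasureTheory.volume.restrict (uIoc a b)) :=
    fun k hk => by
      rw [uIoc_of_le hab]
      exact (hk.mono Ioc_subset_Icc_self).aestronglyMeasurable measurableSet_Ioc
  have hc : ∀ ε : ℝ, ContinuousOn (fun x => |f x + ε * g x| ^ s) (Icc a b) := fun ε =>
    (hf.add (continuousOn_const.mul hg)).abs.rpow_const fun _ _ => Or.inr (by linarith)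
  have key := intervalIntegral.hasDerivAt_integral_of_dominated_loc_of_deriv_le
    (μ := MeasureTheory.volume) (a := a) (b := b) (x₀ := (0 : ℝ)) (s := Metric.ball 0 1)
    (F := fun ε x => |f x + ε * g x| ^ s)
    (F' := fun ε x => s * (spow s (f x + ε * g x) * g x))
    (bound := fun x => s * ((|f x| + |g x|) ^ (s - 1) * |g x|))
    (Metric.ball_mem_nhds 0 one_pos)
    (Eventually.of_forall fun ε => hmeas _ (hc ε)) ((hc 0).intervalIntegrable_of_Icc hab)
    (hmeas _ (continuousOn_const.mul (((continuous_spow hs).comp_continuousOn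
      (hf.add (continuousOn_const.mul hg))).mul hg)))
    ?_ ?_ ?_
  · have := key.2
    simpa using this
  · refine Eventually.of_forall fun x _ ε hε => ?_
    rw [Metric.mem_ball, dist_zero_right, Real.norm_eq_abs] at hε
    rw [Real.norm_eq_abs, abs_mul, abs_mul, abs_spow hs, abs_of_pos (by linarith : 0 < s)]
    have : |f x + ε * g x| ≤ |f x| + |g x| := by
      refine (abs_add_le _ _).trans ?_
      rw [abs_mul]
      nlinarith [abs_nonneg (g x)]
    have h2 : |f x + ε * g x| ^ (s - 1) ≤ (|f x| + |g x|) ^ (s - 1) :=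
      Real.rpow_le_rpow (abs_nonneg _) this (by linarith)
    gcongr
  · refine ContinuousOn.intervalIntegrable_of_Icc hab ?_
    exact continuousOn_const.mul (((hf.abs.add hg.abs).rpow_const
      fun _ _ => Or.inr (by linarith)).mul hg.abs)
  · refine Eventually.of_forall fun x _ ε _ => ?_
    have h1 : HasDerivAt (fun ε : ℝ => f x + ε * g x) (g x) ε := by
      simpa using ((hasDerivAt_id ε).mul_const (g x)).const_add (f x)
    refine ((hasDerivAt_abs_rpow_spow hs (f x + ε * g x)).comp ε h1).congr_deriv ?_
    ring

lemma exists_bound {a b : ℝ} {f : ℝ → ℝ} (hf : ContinuousOn f (Icc a b)) :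
    ∃ C, 0 < C ∧ ∀ x ∈ Icc a b, |f x| ≤ C := by
  obtain ⟨C, hC⟩ := isCompact_Icc.exists_bound_of_continuousOn hf
  exact ⟨|C| + 1, by positivity, fun x hx => (hC x hx).trans (by linarith [le_abs_self C])⟩

/-- For a fixed direction and a small parameter, the competitor lies in the range covered by the
minimality. -/
lemma eventually_abs_mul_le {a b δ : ℝ} (hδ : 0 < δ) {f : ℝ → ℝ}
    (hf : ContinuousOn f (Icc a b)) : ∀ᶠ ε in 𝓝 (0 : ℝ), ∀ x ∈ Icc a b, |ε * f x| ≤ δ := by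
  obtain ⟨C, hC, hfC⟩ := exists_bound hf
  filter_upwards [Metric.ball_mem_nhds (0 : ℝ) (div_pos hδ hC)] with ε hε x hx
  rw [Metric.mem_ball, dist_zero_right, Real.norm_eq_abs, lt_div_iff₀ hC] at hε
  rw [abs_mul]
  exact (mul_le_mul_of_nonneg_left (hfC x hx) (abs_nonneg ε)).trans hε.le

/-- The first variation in odd directions, along which the constraint holds automatically. -/
lemma OddMin.first_variation {p q r a b : ℝ} {u u' : ℝ → ℝ} (hp : 1 < p) (hq : 1 < q)
    (h : OddMin p q r a b u u') {ψ ψ' : ℝ → ℝ} (hψ : C1On a b ψ ψ')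
    (hodd : ∀ x ∈ Icc a b, ψ (a + b - x) = -ψ x) :
    ∫ x in a..b, spow p (u' x) * ψ' x =
      (∫ x in a..b, |u' x| ^ p) / (∫ x in a..b, |u x| ^ q) *
        ∫ x in a..b, spow q (u x) * ψ x := by
  have hE := h.energy_pos hp
  have hN := h.norm_pos hq
  have dE := hasDerivAt_integral_abs_rpow h.lt.le hp h.c1On.continuousOn_deriv
    hψ.continuousOn_deriv
  have dN := hasDerivAt_integral_abs_rpow h.lt.le hq h.c1On.continuousOn hψ.continuousOn
  set E : ℝ → ℝ := fun ε => ∫ x in a..b, |u' x + ε * ψ' x| ^ p with hEdef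
  set N : ℝ → ℝ := fun ε => ∫ x in a..b, |u x + ε * ψ x| ^ q with hNdef
  have E0 : E 0 = ∫ x in a..b, |u' x| ^ p := by simp [hEdef]
  have N0 : N 0 = ∫ x in a..b, |u x| ^ q := by simp [hNdef]
  rw [← E0] at hE ⊢
  rw [← N0] at hN ⊢
  have dL := ((dE.log hE.ne').const_mul (1 / p)).sub ((dN.log hN.ne').const_mul (1 / q))
  have hmin : IsLocalMin (fun ε => 1 / p * Real.log (E ε) - 1 / q * Real.log (N ε)) 0 := by
    obtain ⟨δ, hδ, hmin⟩ := h.isMin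
    filter_upwards [eventually_abs_mul_le hδ hψ.continuousOn,
      eventually_abs_mul_le hδ hψ.continuousOn_deriv,
      dE.continuousAt.eventually_const_lt hE, dN.continuousAt.eventually_const_lt hN]
      with ε h1 h2 hEε hNε
    rw [← ratio_le_ratio_iff hE hN hEε hNε]
    have := hmin _ _ (hψ.const_mul ε) h1 h2 (integral_eq_zero_of_odd h.lt.le fun x hx => by
      rw [h.odd x hx, hodd x hx, ← spow_neg]; congr 1; ring)
    rw [E0, N0]
    exact this
  have h0 := hmin.hasDerivAt_eq_zero dL
  have hp0 : p ≠ 0 := by linarith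
  have hq0 : q ≠ 0 := by linarith
  field_simp at h0 ⊢
  linarith

/-- The Euler-Lagrange equation in integrated form. The multiplier of the constraint is absent
because the first variation only involves odd directions. -/
lemma OddMin.euler_lagrange {p q r a b : ℝ} {u u' : ℝ → ℝ} (hp : 1 < p) (hq : 1 < q)
    (h : OddMin p q r a b u u') : ∀ x ∈ Icc a b, spow p (u' x) =
      -((∫ x in a..b, |u' x| ^ p) / (∫ x in a..b, |u x| ^ q)) * ∫ t in a..x, spow q (u t) := by
  set κ := (∫ x in a..b, |u' x| ^ p) / (∫ x in a..b, |u x| ^ q) with hκ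
  have hab := h.lt.le
  have hS : ContinuousOn (fun x => spow q (u x)) (Icc a b) :=
    (continuous_spow hq).comp_continuousOn h.c1On.continuousOn
  have hm : ContinuousOn (fun x => spow p (u' x)) (Icc a b) :=
    (continuous_spow hp).comp_continuousOn h.c1On.continuousOn_deriv
  have hV := C1On.primitive (left_mem_Icc.2 hab) hS
  set V : ℝ → ℝ := fun x => ∫ t in a..x, spow q (u t) with hVdef
  have hVa : V a = 0 := by simp [hVdef]
  have hSodd : ∀ x ∈ Icc a b, spow q (u (a + b - x)) = -spow q (u x) := fun x hx => by
    rw [h.odd x hx, spow_neg]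
  have hVb : V b = 0 := integral_eq_zero_of_odd hab hSodd
  have hVeven : ∀ x ∈ Icc a b, V (a + b - x) = V x := by
    have key : ∀ x ∈ Icc a b, V (a + b - x) - V x = V (a + b - a) - V a := by
      have hd : C1On a b (fun x => V (a + b - x) + -1 * V x) fun _ => 0 := by
        refine ⟨continuousOn_const, fun x hx => ?_⟩
        have h1 : HasDerivWithinAt (fun y => V (a + b - y)) (spow q (u (a + b - x)) * (-1))
            (Icc a b) x :=
          (hV.2 _ (reflect_mem hx)).comp x ((hasDerivWithinAt_id x _).const_sub (a + b))
            fun y hy => reflect_mem hy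
        refine (h1.add ((hV.2 x hx).const_mul (-1))).congr_deriv ?_
        rw [hSodd x hx]; ring
      have hc := constant_of_has_deriv_right_zero hd.continuousOn fun x hx =>
        ((hd.2 x (Ico_subset_Icc_self hx)).mono (Icc_subset_Icc_left hx.1)).mono_of_mem_nhdsWithin
          (Icc_mem_nhdsGE hx.2)
      intro x hx
      have := hc x hx
      linarith
    intro x hx
    have := key x hx
    rw [add_sub_cancel_left, hVa, hVb] at this
    linarith
  have hk : ContinuousOn (fun x => spow p (u' x) + κ * V x) (Icc a b) :=
    hm.add (continuousOn_const.mul hV.continuousOn)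
  set k : ℝ → ℝ := fun x => spow p (u' x) + κ * V x with hkdef
  have hkeven : ∀ x ∈ Icc a b, k (a + b - x) = k x := fun x hx => by
    simp only [hkdef, h.deriv_even x hx, hVeven x hx]
  have hmid : (a + b) / 2 ∈ Icc a b := ⟨by linarith, by linarith⟩
  -- du Bois-Reymond: the odd primitive `ψ` of `k` is a test function, and it gives `∫ k ^ 2 = 0`
  have hψ := C1On.primitive hmid hk
  have hψodd : ∀ x ∈ Icc a b, (∫ t in (a + b) / 2..(a + b - x), k t) =
      -∫ t in (a + b) / 2..x, k t := fun x hx => by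
    have h1 : ∫ t in (a + b) / 2..x, k (a + b - t) = ∫ t in (a + b - x)..(a + b) / 2, k t := by
      rw [intervalIntegral.integral_comp_sub_left]
      congr 1
      ring
    rw [intervalIntegral.integral_symm, ← h1]
    congr 1
    exact intervalIntegral.integral_congr fun t ht => hkeven t (uIcc_subset_Icc hmid hx ht)
  have hfv := h.first_variation hp hq hψ hψodd
  have hparts := (hV.mul hψ).integral_deriv hab
  have i1 : IntervalIntegrable (fun x => spow q (u x) * ∫ t in (a + b) / 2..x, k t)
    MeasureTheory.volume a b := (hS.mul hψ.continuousOn).intervalIntegrable_of_Icc hab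
  have i2 : IntervalIntegrable (fun x => V x * k x) MeasureTheory.volume a b :=
    (hV.continuousOn.mul hk).intervalIntegrable_of_Icc hab
  have i3 : IntervalIntegrable (fun x => spow p (u' x) * k x) MeasureTheory.volume a b :=
    (hm.mul hk).intervalIntegrable_of_Icc hab
  rw [hVa, hVb, zero_mul, zero_mul, sub_zero, intervalIntegral.integral_add i1 i2] at hparts
  have hsq : ∫ x in a..b, k x ^ 2 = 0 := by
    have e : ∀ x, k x ^ 2 = spow p (u' x) * k x + κ * (V x * k x) := fun x => by
      simp only [hkdef]; ring
    simp only [e]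
    rw [intervalIntegral.integral_add i3 (i2.const_mul κ),
      intervalIntegral.integral_const_mul, hfv, ← hκ, ← mul_add, hparts, mul_zero]
  intro x hx
  by_contra hne
  have hpos : 0 < ∫ x in a..b, k x ^ 2 :=
    intervalIntegral.integral_pos h.lt (hk.pow 2) (fun x _ => sq_nonneg _)
      ⟨x, hx, by
        have : k x ≠ 0 := fun h0 => hne (by simp only [hkdef] at h0; linarith)
        positivity⟩
  linarith

/-! ### Functions with nondegenerate zeros -/

/-- An accumulation point of zeros would be a degenerate zero. -/
lemma C1On.finite_zeros {a b : ℝ} {u u' : ℝ → ℝ} (h : C1On a b u u')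
    (h0 : ∀ x ∈ Icc a b, u x = 0 → u' x ≠ 0) : {x ∈ Icc a b | u x = 0}.Finite := by
  by_contra hinf
  obtain ⟨x, hx, hacc⟩ := Set.Infinite.exists_accPt_of_subset_isCompact hinf isCompact_Icc
    (sep_subset _ _)
  rw [accPt_iff_frequently] at hacc
  have hcont := h.continuousOn x hx
  have hux : u x = 0 := by
    by_contra hne
    have := hcont.eventually_ne hne
    rw [eventually_nhdsWithin_iff] at this
    obtain ⟨y, ⟨-, hy⟩, hy'⟩ := (hacc.and_eventually this).exists
    exact hy' hy.1 hy.2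
  have := (h.hasDerivWithinAt x hx).eventually_ne (c := 0) (h0 x hx hux)
  rw [eventually_nhdsWithin_iff] at this
  obtain ⟨y, ⟨hne, hy⟩, hy'⟩ := (hacc.and_eventually this).exists
  exact hy' ⟨hy.1, hne⟩ hy.2

lemma intervalIntegrable_abs_sub_rpow {e : ℝ} (he : -1 < e) (a b c : ℝ) :
    IntervalIntegrable (fun x => |x - c| ^ e) MeasureTheory.volume a b := by
  have h : MeasureTheory.LocallyIntegrable (fun x : ℝ => |x| ^ e) MeasureTheory.volume := by
    refine MeasureTheory.locallyIntegrable_of_norm_le_rpow (C := 1) (α := -e) (by simp)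
      (by simpa using (by linarith : -e < 1)) (Eventually.of_forall fun x => ?_)
      (measurable_id.abs.pow_const e).aestronglyMeasurable
    rw [neg_neg, one_mul, Real.norm_eq_abs, Real.norm_eq_abs,
      abs_of_nonneg (Real.rpow_nonneg (abs_nonneg x) e)]
  have h1 : IntervalIntegrable (fun x : ℝ => |x| ^ e) MeasureTheory.volume (a - c) (b - c) :=
    (h.integrableOn_isCompact isCompact_uIcc).intervalIntegrable
  have h2 := h1.comp_sub_right c
  simpa using h2

/-- Near a nondegenerate zero `c` the function is bounded below by a multiple of `|x - c|`, so that
all its powers with exponent greater than `-1` are integrable. -/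
lemma C1On.intervalIntegrable_abs_rpow {a b e : ℝ} {u u' : ℝ → ℝ} (hab : a ≤ b)
    (h : C1On a b u u') (h0 : ∀ x ∈ Icc a b, u x = 0 → u' x ≠ 0) (he : -1 < e) :
    IntervalIntegrable (fun x => |u x| ^ e) MeasureTheory.volume a b := by
  rw [intervalIntegrable_iff_integrableOn_Icc_of_le hab]
  rcases le_or_gt 0 e with he0 | he0
  · exact (h.continuousOn.abs.rpow_const fun _ _ => Or.inr he0).integrableOn_Icc
  have hmeas : MeasureTheory.AEStronglyMeasurable (fun x => |u x| ^ e)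
      (MeasureTheory.volume.restrict (Icc a b)) :=
    ((h.continuousOn.abs.aemeasurable measurableSet_Icc).pow_const e).aestronglyMeasurable
  have hloc : MeasureTheory.LocallyIntegrableOn (fun x => |u x| ^ e) (Icc a b) := by
    intro x hx
    by_cases hux : u x = 0
    · have hd := h0 x hx hux
      have hd' : 0 < |u' x| / 2 := by have := abs_pos.2 hd; positivity
      have hlo := (hasDerivWithinAt_iff_isLittleO.1 (h.hasDerivWithinAt x hx)).bound hd'
      rw [hux] at hlo
      refine ⟨{y ∈ Icc a b | |u' x| / 2 * |y - x| ≤ |u y|}, ?_, ?_⟩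
      · filter_upwards [hlo, self_mem_nhdsWithin] with y hy hyI
        refine ⟨hyI, ?_⟩
        rw [sub_zero, smul_eq_mul, Real.norm_eq_abs, Real.norm_eq_abs] at hy
        have := abs_sub_abs_le_abs_sub ((y - x) * u' x) (u y)
        rw [abs_sub_comm, abs_mul] at this
        nlinarith
      · have hsub : {y ∈ Icc a b | |u' x| / 2 * |y - x| ≤ |u y|} ⊆ Icc a b := sep_subset _ _
        have hms : MeasurableSet {y ∈ Icc a b | |u' x| / 2 * |y - x| ≤ |u y|} := by
          have hc : IsClosed {y ∈ Icc a b | |u' x| / 2 * |y - x| ≤ |u y|} :=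
            isClosed_Icc.isClosed_le (by fun_prop) h.continuousOn.abs
          exact hc.measurableSet
        have hg : MeasureTheory.IntegrableOn (fun y => (|u' x| / 2) ^ e * |y - x| ^ e)
            (Icc a b) := by
          have := (intervalIntegrable_abs_sub_rpow he a b x).const_mul ((|u' x| / 2) ^ e)
          rwa [intervalIntegrable_iff_integrableOn_Icc_of_le hab] at this
        refine MeasureTheory.Integrable.mono' (hg.mono_set hsub)
          (hmeas.mono_measure (MeasureTheory.Measure.restrict_mono hsub le_rfl)) ?_
        refine (MeasureTheory.ae_restrict_iff' hms).2 (Eventually.of_forall fun y hy => ?_)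
        rw [Real.norm_eq_abs, abs_of_nonneg (Real.rpow_nonneg (abs_nonneg _) _)]
        rcases eq_or_ne y x with rfl | hyx
        · simp [hux, Real.zero_rpow he0.ne]
        · rw [← Real.mul_rpow hd'.le (abs_nonneg _)]
          exact Real.rpow_le_rpow_of_nonpos
            (mul_pos hd' (abs_pos.2 (sub_ne_zero.2 hyx))) hy.2 he0.le
    · have hc : ContinuousWithinAt (fun x => |u x| ^ e) (Icc a b) x :=
        (h.continuousOn x hx).abs.rpow_const (Or.inl (abs_pos.2 hux).ne')
      exact hc.integrableAtFilter ⟨Icc a b, self_mem_nhdsWithin, hmeas⟩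
        (MeasureTheory.Measure.finiteAt_nhdsWithin _ _ _)
  exact hloc.integrableOn_isCompact isCompact_Icc

/-! ### Normalized extremals -/

/-- The information on an odd local minimizer that is used below, after normalization of its
maximum: the Euler-Lagrange equation without multiplier, its first integral, and the Neumann
condition, in the form `|u| = 1` at the endpoints. -/
structure Extremal (p q κ a b : ℝ) (u u' : ℝ → ℝ) : Prop where
  lt : a < b
  c1On : C1On a b u u'
  pos : 0 < κ
  euler : C1On a b (fun x => spow p (u' x)) (fun x => -κ * spow q (u x))
  energy : ∀ x ∈ Icc a b, |u' x| ^ p = κ * p / (q * (p - 1)) * (1 - |u x| ^ q)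
  abs_left : |u a| = 1
  abs_right : |u b| = 1

/-- The Euler-Lagrange equation in differentiated form, and its first integral. The constant of
integration is found at `a`, where `u'` vanishes. -/
lemma OddMin.energy {p q r a b : ℝ} {u u' : ℝ → ℝ} (hp : 1 < p) (hq : 1 < q)
    (h : OddMin p q r a b u u') :
    C1On a b (fun x => spow p (u' x)) (fun x =>
      -((∫ x in a..b, |u' x| ^ p) / (∫ x in a..b, |u x| ^ q)) * spow q (u x)) ∧
    ∀ x ∈ Icc a b, |u' x| ^ p = (∫ x in a..b, |u' x| ^ p) / (∫ x in a..b, |u x| ^ q) * p /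
      (q * (p - 1)) * (|u a| ^ q - |u x| ^ q) := by
  set κ := (∫ x in a..b, |u' x| ^ p) / (∫ x in a..b, |u x| ^ q) with hκ
  have hEL := h.euler_lagrange hp hq
  rw [← hκ] at hEL
  have hab := h.lt.le
  have hS : ContinuousOn (fun x => spow q (u x)) (Icc a b) :=
    (continuous_spow hq).comp_continuousOn h.c1On.continuousOn
  have hm : C1On a b (fun x => spow p (u' x)) (fun x => -κ * spow q (u x)) := by
    have := (C1On.primitive (left_mem_Icc.2 hab) hS).const_mul (-κ)
    exact ⟨this.1, fun x hx => (this.2 x hx).congr hEL (hEL x hx)⟩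
  refine ⟨hm, ?_⟩
  have hp1 : 0 < p - 1 := by linarith
  have hs : 1 < p / (p - 1) := by rw [lt_div_iff₀ hp1]; linarith
  have hconj : (p - 1) * (p / (p - 1) - 1) = 1 := by field_simp; ring
  have hpow : ∀ y : ℝ, |spow p y| ^ (p / (p - 1)) = |y| ^ p := fun y => by
    rw [abs_spow hp, ← Real.rpow_mul (abs_nonneg y)]
    congr 1
    field_simp
  have hH : ∀ x ∈ Icc a b, HasDerivWithinAt
      (fun x => (p - 1) / p * |spow p (u' x)| ^ (p / (p - 1)) + κ / q * |u x| ^ q) 0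
      (Icc a b) x := fun x hx => by
    have d1 := (hasDerivAt_abs_rpow_spow hs (spow p (u' x))).comp_hasDerivWithinAt x (hm.2 x hx)
    have d2 := (hasDerivAt_abs_rpow_spow hq (u x)).comp_hasDerivWithinAt x
      (h.c1On.2 x hx)
    refine ((d1.const_mul ((p - 1) / p)).add (d2.const_mul (κ / q))).congr_deriv ?_
    rw [spow_spow hconj]
    have : q ≠ 0 := by linarith
    field_simp
    ring
  have hconst := constant_of_has_deriv_right_zero
    (fun x hx => (hH x hx).continuousWithinAt) fun x hx =>
      ((hH x (Ico_subset_Icc_self hx)).mono (Icc_subset_Icc_left hx.1)).mono_of_mem_nhdsWithin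
        (Icc_mem_nhdsGE hx.2)
  have hu'a : |u' a| ^ p = 0 := by
    have h1 := hEL a (left_mem_Icc.2 hab)
    rw [intervalIntegral.integral_same, mul_zero] at h1
    have h2 : spow (p / (p - 1)) (spow p (u' a)) = u' a := spow_spow hconj _
    rw [h1, spow_zero] at h2
    rw [← h2, abs_zero, Real.zero_rpow (by linarith)]
  intro x hx
  have := hconst x hx
  rw [hpow, hpow, hu'a] at this
  have hq0 : q ≠ 0 := by linarith
  field_simp at this ⊢
  linarith

/-- After multiplication by a constant, an odd local minimizer is an `Extremal`. -/
lemma OddMin.exists_extremal {p q r a b : ℝ} {u u' : ℝ → ℝ} (hp : 1 < p) (hq : 1 < q)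
    (h : OddMin p q r a b u u') :
    ∃ v v' : ℝ → ℝ, OddMin p q r a b v v' ∧
      Extremal p q ((∫ x in a..b, |v' x| ^ p) / (∫ x in a..b, |v x| ^ q)) a b v v' := by
  have hua : u a ≠ 0 := by
    intro h0
    have hE := (h.energy hp hq).2
    have hle : ∫ x in a..b, |u' x| ^ p ≤ ∫ x in a..b, (0 : ℝ) := by
      refine intervalIntegral.integral_mono_on h.lt.le
        ((h.c1On.continuousOn_deriv.abs.rpow_const
          fun _ _ => Or.inr (by linarith)).intervalIntegrable_of_Icc h.lt.le) (by simp) ?_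
      intro x hx
      rw [hE x hx, h0, abs_zero, Real.zero_rpow (by linarith), zero_sub]
      have h1 := h.energy_pos hp
      have h2 := h.norm_pos hq
      have h3 : 0 < p - 1 := by linarith
      have h4 := Real.rpow_nonneg (abs_nonneg (u x)) q
      refine mul_nonpos_of_nonneg_of_nonpos ?_ (by linarith)
      positivity
    rw [intervalIntegral.integral_zero] at hle
    exact absurd (h.energy_pos hp) (not_lt.2 hle)
  have hc : 0 < |u a|⁻¹ := inv_pos.2 (abs_pos.2 hua)
  have hv := h.const_mul hp hq hc
  have hE := hv.energy hp hq
  have hva : |(|u a|⁻¹ * u a)| = 1 := by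
    rw [abs_mul, abs_of_pos hc, inv_mul_cancel₀ (abs_pos.2 hua).ne']
  refine ⟨_, _, hv, hv.lt, hv.c1On, div_pos (hv.energy_pos hp) (hv.norm_pos hq), hE.1, ?_, hva, ?_⟩
  · intro x hx
    have := hE.2 x hx
    rw [hva, Real.one_rpow] at this
    exact this
  · have := hv.odd a (left_mem_Icc.2 hv.lt.le)
    rw [add_sub_cancel_left] at this
    rw [this, abs_neg, hva]

namespace Extremal

variable {p q κ a b : ℝ} {u u' : ℝ → ℝ}

lemma coeff_pos (hp : 1 < p) (hq : 1 < q) (h : Extremal p q κ a b u u') :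
    0 < κ * p / (q * (p - 1)) := by
  have := h.pos
  have h3 : 0 < p - 1 := by linarith
  positivity

lemma abs_le_one (hp : 1 < p) (hq : 1 < q) (h : Extremal p q κ a b u u') {x : ℝ}
    (hx : x ∈ Icc a b) : |u x| ≤ 1 := by
  have h1 := h.energy x hx
  have h2 := Real.rpow_nonneg (abs_nonneg (u' x)) p
  rw [h1] at h2
  have h3 := nonneg_of_mul_nonneg_right h2 (h.coeff_pos hp hq)
  by_contra! h4
  have := Real.one_lt_rpow h4 (by linarith : 0 < q)
  linarith

lemma deriv_eq_zero_iff (hp : 1 < p) (hq : 1 < q) (h : Extremal p q κ a b u u') {x : ℝ}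
    (hx : x ∈ Icc a b) : u' x = 0 ↔ |u x| = 1 := by
  have h1 := h.energy x hx
  constructor
  · intro h0
    rw [h0, abs_zero, Real.zero_rpow (by linarith), eq_comm, mul_eq_zero] at h1
    have h2 := h1.resolve_left (h.coeff_pos hp hq).ne'
    have h3 : |u x| ^ q = 1 := by linarith
    exact (Real.rpow_left_inj (abs_nonneg _) zero_le_one (by linarith : q ≠ 0)).1
      (by rw [h3, Real.one_rpow])
  · intro h0
    rw [h0, Real.one_rpow, sub_self, mul_zero] at h1
    exact abs_eq_zero.1 ((Real.rpow_eq_zero (abs_nonneg _) (by linarith)).1 h1)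

lemma deriv_ne_zero (hp : 1 < p) (hq : 1 < q) (h : Extremal p q κ a b u u') :
    ∀ x ∈ Icc a b, u x = 0 → u' x ≠ 0 := fun x hx h0 h1 => by
  rw [h.deriv_eq_zero_iff hp hq hx, h0, abs_zero] at h1
  exact zero_ne_one h1

/-- Zeros and critical points of an extremal are isolated. -/
lemma finite_exceptional (hp : 1 < p) (hq : 1 < q) (h : Extremal p q κ a b u u') :
    {x ∈ Icc a b | u x = 0 ∨ u' x = 0}.Finite := by
  have h1 := h.c1On.finite_zeros (h.deriv_ne_zero hp hq)
  have h2 := h.euler.finite_zeros fun x hx h0 => by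
    have h3 : u' x = 0 := by
      by_contra hne
      have := abs_spow hp (u' x)
      rw [h0, abs_zero] at this
      exact (Real.rpow_pos_of_pos (abs_pos.2 hne) _).ne this
    have h4 := (h.deriv_eq_zero_iff hp hq hx).1 h3
    have h5 : spow q (u x) ≠ 0 := by
      rw [← abs_ne_zero, abs_spow hq, h4, Real.one_rpow]
      exact one_ne_zero
    exact mul_ne_zero (neg_ne_zero.2 h.pos.ne') h5
  refine (h1.union h2).subset ?_
  rintro x ⟨hx, h0 | h0⟩
  · exact Or.inl ⟨hx, h0⟩
  · exact Or.inr ⟨hx, by rw [h0, spow_zero]⟩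

lemma intervalIntegrable (hp : 1 < p) (hq : 1 < q) (h : Extremal p q κ a b u u') {e : ℝ}
    (he : -1 < e) : IntervalIntegrable (fun x => |u x| ^ e) MeasureTheory.volume a b :=
  h.c1On.intervalIntegrable_abs_rpow h.lt.le (h.deriv_ne_zero hp hq) he

end Extremal

/-! ### The profile of the destabilizing direction -/

lemma one_sub_rpow_le {t α : ℝ} (ht : 0 ≤ t) (ht1 : t ≤ 1) (hα : 0 ≤ α) :
    1 - t ^ α ≤ (1 + α) * (1 - t) := by
  rcases le_or_gt 1 α with h | h
  · have := one_add_mul_self_le_rpow_one_add (s := t - 1) (by linarith) h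
    rw [add_sub_cancel] at this
    nlinarith
  · rcases ht.eq_or_lt with rfl | ht
    · have := Real.rpow_nonneg (le_refl (0 : ℝ)) α
      linarith
    · have := Real.rpow_le_rpow_of_exponent_ge ht ht1 h.le
      rw [Real.rpow_one] at this
      nlinarith

lemma abs_rpow_sub_rpow_le {t α β : ℝ} (ht : 0 ≤ t) (ht1 : t ≤ 1) (hα : 0 ≤ α) (hβ : 0 ≤ β) :
    |t ^ α - t ^ β| ≤ (2 + α + β) * (1 - t) := by
  have h1 := one_sub_rpow_le ht ht1 hα
  have h2 := one_sub_rpow_le ht ht1 hβ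
  have h3 := Real.rpow_le_one ht ht1 hα
  have h4 := Real.rpow_le_one ht ht1 hβ
  rw [abs_le]
  constructor <;> nlinarith

lemma abs_spow_sub_spow_le {s t y : ℝ} (hs : 1 < s) (ht : 1 < t) (hy : |y| ≤ 1) :
    |spow s y - spow t y| ≤ (s + t) * (1 - |y|) := by
  have h : |spow s y - spow t y| = |(|y| ^ (s - 1)) - |y| ^ (t - 1)| := by
    rw [← spow_of_nonneg hs (abs_nonneg y), ← spow_of_nonneg ht (abs_nonneg y)]
    rcases abs_choice y with h | h <;> rw [h]
    rw [spow_neg, spow_neg, ← neg_sub', abs_neg]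
  rw [h]
  refine (abs_rpow_sub_rpow_le (abs_nonneg y) hy (by linarith) (by linarith)).trans (le_of_eq ?_)
  ring

lemma abs_rpow_le_self {q y : ℝ} (hq : 1 < q) (hy : |y| ≤ 1) : |y| ^ q ≤ |y| := by
  rcases (abs_nonneg y).eq_or_lt with h | h
  · rw [← h, Real.zero_rpow (by linarith)]
  · have := Real.rpow_le_rpow_of_exponent_ge h hy hq.le
    rwa [Real.rpow_one] at this

lemma one_sub_abs_rpow_pos {q y : ℝ} (hq : 1 < q) (hy : |y| < 1) : 0 < 1 - |y| ^ q := by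
  linarith [abs_rpow_le_self hq hy.le]

/-- An even solution `f` on `[-1, 1]` of the linear equation
`(1 - |y|^q) f' + (q/p) |y|^(q-2) y f = |y|^(r-2) y`, the one that is Lipschitz up to the
singular points `±1`; there `f = p/q`. In `deriv_eq` the division by zero gives `f' = 0` at `±1`,
where `f'` need not be the derivative of `f`. -/
structure IsProfile (p q r C : ℝ) (f f' : ℝ → ℝ) : Prop where
  even : ∀ y, |y| ≤ 1 → f (-y) = f y
  hasDerivAt : ∀ y, |y| < 1 → HasDerivAt f (f' y) y
  deriv_eq : ∀ y, f' y = (spow r y - q / p * spow q y * f y) / (1 - |y| ^ q)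
  near_one : ∀ y, |y| ≤ 1 → |f y - p / q| ≤ C * (1 - |y|)
  deriv_le : ∀ y, |y| ≤ 1 → |f' y| ≤ C

lemma intervalIntegrable_one_sub_abs_rpow {e y z : ℝ} (he : -1 < e) (hy : y ∈ Icc (-1 : ℝ) 1)
    (hz : z ∈ Icc (-1 : ℝ) 1) :
    IntervalIntegrable (fun t : ℝ => (1 - |t|) ^ e) MeasureTheory.volume y z := by
  have h1 : IntervalIntegrable (fun t : ℝ => (1 - |t|) ^ e) MeasureTheory.volume (-1) 0 := by
    refine (intervalIntegrable_abs_sub_rpow he (-1) 0 (-1)).congr fun t ht => ?_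
    rw [uIoc_of_le (by norm_num)] at ht
    have ht2 := ht.1
    rw [abs_of_nonpos ht.2, abs_of_nonneg (by linarith : 0 ≤ t - -1)]
    congr 1; ring
  have h2 : IntervalIntegrable (fun t : ℝ => (1 - |t|) ^ e) MeasureTheory.volume 0 1 := by
    refine (intervalIntegrable_abs_sub_rpow he 0 1 1).congr fun t ht => ?_
    rw [uIoc_of_le (by norm_num)] at ht
    have ht2 := ht.2
    rw [abs_of_nonneg ht.1.le, abs_of_nonpos (by linarith : t - 1 ≤ 0)]
    congr 1; ring
  refine (h1.trans h2).mono_set ?_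
  rw [uIcc_of_le (by norm_num : (-1 : ℝ) ≤ 1)]
  exact uIcc_subset_Icc hy hz

lemma integral_one_sub_rpow {e : ℝ} (he : -1 < e) (y : ℝ) :
    ∫ t in y..1, (1 - t) ^ e = (1 - y) ^ (e + 1) / (e + 1) := by
  rw [intervalIntegral.integral_comp_sub_left (fun t => t ^ e), integral_rpow (Or.inl he)]
  rw [sub_self, Real.zero_rpow (by linarith), sub_zero]

/-- Variation of constants, with the homogeneous solution `(1 - |y|^q)^(1/p)` and the integral
taken from the singular point `1`. -/
lemma exists_profile {p q r : ℝ} (hp : 1 < p) (hq : 1 < q) (hr : 1 < r) :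
    ∃ C f f', 0 ≤ C ∧ IsProfile p q r C f f' := by
  have hp0 : 0 < p := by linarith
  have hq0 : 0 < q := by linarith
  have hpinv : 1 / p < 1 := by rw [div_lt_one hp0]; exact hp
  have hpinv0 : 0 < 1 / p := by positivity
  set w : ℝ → ℝ := fun y => 1 - |y| ^ q with hw
  set i : ℝ → ℝ := fun t => (spow r t - spow q t) * w t ^ (-(1 / p) - 1) with hi
  set I : ℝ → ℝ := fun y => ∫ t in y..1, i t with hI
  set f : ℝ → ℝ := fun y => p / q - w y ^ (1 / p) * I y with hf
  have hwpos : ∀ y, |y| < 1 → 0 < w y := fun y hy => one_sub_abs_rpow_pos hq hy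
  have hwge : ∀ y, |y| ≤ 1 → 1 - |y| ≤ w y := fun y hy => by
    have := abs_rpow_le_self hq hy
    simp only [hw]; linarith
  have hwle : ∀ y, |y| ≤ 1 → w y ≤ (1 + q) * (1 - |y|) := fun y hy =>
    one_sub_rpow_le (abs_nonneg y) hy hq0.le
  have hwabs : Continuous w :=
    continuous_const.sub (continuous_abs.rpow_const fun _ => Or.inr hq0.le)
  have hile : ∀ t, |t| ≤ 1 → |i t| ≤ (r + q) * (1 - |t|) ^ (-(1 / p)) := fun t ht => by
    rcases ht.eq_or_lt with h | h
    · have h0 : spow r t - spow q t = 0 := by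
        have := abs_spow_sub_spow_le hr hq ht
        rw [h, sub_self, mul_zero] at this
        exact abs_nonpos_iff.1 this
      simp only [hi, h0, zero_mul, abs_zero]
      exact mul_nonneg (by linarith) (Real.rpow_nonneg (by linarith) _)
    · have h1 : 0 < 1 - |t| := by linarith
      have h2 : w t ^ (-(1 / p) - 1) ≤ (1 - |t|) ^ (-(1 / p) - 1) :=
        Real.rpow_le_rpow_of_nonpos h1 (hwge t ht) (by linarith)
      have h3 := Real.rpow_nonneg (hwpos t h).le (-(1 / p) - 1)
      simp only [hi]
      rw [abs_mul, abs_of_nonneg h3]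
      calc |spow r t - spow q t| * w t ^ (-(1 / p) - 1)
          ≤ ((r + q) * (1 - |t|)) * (1 - |t|) ^ (-(1 / p) - 1) := by
            gcongr
            exact abs_spow_sub_spow_le hr hq ht
        _ = (r + q) * (1 - |t|) ^ (-(1 / p)) := by
            rw [Real.rpow_sub_one h1.ne']; field_simp
  have himeas : Measurable i :=
    (((continuous_spow hr).sub (continuous_spow hq)).measurable).mul
      (hwabs.measurable.pow_const _)
  have hiint : ∀ {y z : ℝ}, y ∈ Icc (-1 : ℝ) 1 → z ∈ Icc (-1 : ℝ) 1 →
      IntervalIntegrable i MeasureTheory.volume y z := fun {y z} hy hz => by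
    refine ((intervalIntegrable_one_sub_abs_rpow (by linarith : -1 < -(1 / p)) hy hz).const_mul
      (r + q)).mono_fun' himeas.aestronglyMeasurable ?_
    refine (MeasureTheory.ae_restrict_iff' measurableSet_uIoc).2
      (Eventually.of_forall fun t ht => ?_)
    have := uIcc_subset_Icc hy hz (uIoc_subset_uIcc ht)
    exact hile t (abs_le.2 this)
  have h1mem : (1 : ℝ) ∈ Icc (-1 : ℝ) 1 := by constructor <;> norm_num
  have hIeven : ∀ y, |y| ≤ 1 → I (-y) = I y := by
    have key : ∀ y, 0 ≤ y → y ≤ 1 → I (-y) = I y := fun y hy0 hy1 => by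
      have hm : y ∈ Icc (-1 : ℝ) 1 := ⟨by linarith, hy1⟩
      have hm' : -y ∈ Icc (-1 : ℝ) 1 := ⟨by linarith, by linarith⟩
      have h0 : ∫ t in (-y)..y, i t = 0 := by
        refine integral_eq_zero_of_odd (by linarith) fun t _ => ?_
        simp only [hi, hw, neg_add_cancel, zero_sub, spow_neg, abs_neg]
        ring
      have := intervalIntegral.integral_add_adjacent_intervals (hiint hm' hm) (hiint hm h1mem)
      simp only [hI]
      rw [← this, h0, zero_add]
    intro y hy
    rcases le_total 0 y with h | h
    · exact key y h (le_of_abs_le hy)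
    · have := key (-y) (by linarith) (by linarith [(abs_le.1 hy).1])
      rw [neg_neg] at this
      exact this.symm
  have hIle : ∀ y, 0 ≤ y → y ≤ 1 →
      |I y| ≤ (r + q) * ((1 - y) ^ (1 - 1 / p) / (1 - 1 / p)) := fun y hy0 hy1 => by
    have hm : y ∈ Icc (-1 : ℝ) 1 := ⟨by linarith, hy1⟩
    have h1 : |I y| ≤ ∫ t in y..1, (r + q) * (1 - |t|) ^ (-(1 / p)) := by
      rw [← Real.norm_eq_abs]
      refine intervalIntegral.norm_integral_le_of_norm_le hy1 (Eventually.of_forall fun t ht => ?_)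
        ((intervalIntegrable_one_sub_abs_rpow (by linarith) hm h1mem).const_mul _)
      exact hile t (abs_le.2 ⟨by linarith [ht.1], ht.2⟩)
    have h2 : ∫ t in y..1, (r + q) * (1 - |t|) ^ (-(1 / p)) =
        ∫ t in y..1, (r + q) * (1 - t) ^ (-(1 / p)) :=
      intervalIntegral.integral_congr fun t ht => by
        rw [uIcc_of_le hy1] at ht
        simp only [abs_of_nonneg (hy0.trans ht.1)]
    rw [h2, intervalIntegral.integral_const_mul,
      integral_one_sub_rpow (by linarith)] at h1
    have e : -(1 / p) + 1 = 1 - 1 / p := by ring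
    rwa [e] at h1
  have hfeven : ∀ y, |y| ≤ 1 → f (-y) = f y := fun y hy => by
    simp only [hf, hIeven y hy, hw, abs_neg]
  set C1 : ℝ := (1 + q) ^ (1 / p) * ((r + q) / (1 - 1 / p)) with hC1
  have hC1pos : 0 ≤ C1 := by
    have : 0 < 1 - 1 / p := by linarith
    have := Real.rpow_nonneg (by linarith : 0 ≤ 1 + q) (1 / p)
    positivity
  have hnear : ∀ y, |y| ≤ 1 → |f y - p / q| ≤ C1 * (1 - |y|) := by
    have key : ∀ y, 0 ≤ y → y ≤ 1 → |f y - p / q| ≤ C1 * (1 - y) := fun y hy0 hy1 => by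
      have hyabs : |y| ≤ 1 := by rwa [abs_of_nonneg hy0]
      have hw0 : 0 ≤ w y := le_trans (by linarith) (hwge y hyabs)
      have e1 : f y - p / q = -(w y ^ (1 / p) * I y) := by simp only [hf]; ring
      have e2 : w y ^ (1 / p) ≤ (1 + q) ^ (1 / p) * (1 - y) ^ (1 / p) := by
        rw [← Real.mul_rpow (by linarith) (by linarith)]
        refine Real.rpow_le_rpow hw0 ?_ hpinv0.le
        have := hwle y hyabs
        rwa [abs_of_nonneg hy0] at this
      have e3 : (1 - y) ^ (1 / p) * (1 - y) ^ (1 - 1 / p) = 1 - y := by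
        rcases hy1.eq_or_lt with rfl | h
        · rw [sub_self, Real.zero_rpow hpinv0.ne', zero_mul]
        · rw [← Real.rpow_add (by linarith), add_sub_cancel, Real.rpow_one]
      rw [e1, abs_neg, abs_mul, abs_of_nonneg (Real.rpow_nonneg hw0 _)]
      calc w y ^ (1 / p) * |I y|
          ≤ ((1 + q) ^ (1 / p) * (1 - y) ^ (1 / p)) *
            ((r + q) * ((1 - y) ^ (1 - 1 / p) / (1 - 1 / p))) :=
            mul_le_mul e2 (hIle y hy0 hy1) (abs_nonneg _)
              (le_trans (Real.rpow_nonneg hw0 _) e2)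
        _ = (1 + q) ^ (1 / p) * ((r + q) / (1 - 1 / p)) *
            ((1 - y) ^ (1 / p) * (1 - y) ^ (1 - 1 / p)) := by ring
        _ = C1 * (1 - y) := by rw [e3]
    intro y hy
    rcases le_total 0 y with h | h
    · rw [abs_of_nonneg h] at hy ⊢
      exact key y h hy
    · rw [← hfeven y hy]
      rw [abs_of_nonpos h] at hy ⊢
      exact key (-y) (by linarith) hy
  set f' : ℝ → ℝ := fun y => (spow r y - q / p * spow q y * f y) / (1 - |y| ^ q) with hf'
  refine ⟨r + q + C1 + q / p * C1, f, f', by positivity, hfeven, ?_, fun y => rfl, ?_, ?_⟩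
  · intro y hy
    have hy' := abs_lt.1 hy
    have hm : y ∈ Icc (-1 : ℝ) 1 := abs_le.1 hy.le
    have hwy := hwpos y hy
    have hic : ContinuousAt i y :=
      ((continuous_spow hr).continuousAt.sub (continuous_spow hq).continuousAt).mul
        (hwabs.continuousAt.rpow_const (Or.inl hwy.ne'))
    have dI : HasDerivAt I (-i y) y :=
      intervalIntegral.integral_hasDerivAt_left (hiint hm h1mem)
        himeas.stronglyMeasurable.stronglyMeasurableAtFilter hic
    have dw : HasDerivAt w (-(q * spow q y)) y := (hasDerivAt_abs_rpow_spow hq y).const_sub 1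
    have dwp := dw.rpow_const (p := 1 / p) (Or.inl hwy.ne')
    refine ((dwp.mul dI).const_sub (p / q)).congr_deriv ?_
    have e1 : w y ^ (1 / p) * i y * w y = spow r y - spow q y := by
      simp only [hi]
      rw [mul_comm (spow r y - spow q y), ← mul_assoc, ← Real.rpow_add hwy, mul_comm _ (w y),
        ← mul_assoc]
      nth_rewrite 1 [← Real.rpow_one (w y)]
      rw [← Real.rpow_add hwy]
      ring_nf
      rw [Real.rpow_zero, one_mul, one_mul]
    have e2 : w y ^ (1 / p - 1) * w y = w y ^ (1 / p) := by
      rw [Real.rpow_sub_one hwy.ne', div_mul_cancel₀ _ hwy.ne']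
    have e3 : 1 - |y| ^ q = w y := rfl
    simp only [hf']
    rw [e3, eq_div_iff hwy.ne']
    have e4 : q / p * spow q y * f y = spow q y - q / p * spow q y * (w y ^ (1 / p) * I y) := by
      simp only [hf]
      field_simp
    rw [e4, ← e2]
    rw [← e2] at e1
    linear_combination e1
  · intro y hy
    refine (hnear y hy).trans ?_
    have : 0 ≤ 1 - |y| := by linarith
    gcongr
    have : 0 ≤ q / p * C1 := by positivity
    linarith
  · intro y hy
    rcases hy.eq_or_lt with h | h
    · simp only [hf', h, Real.one_rpow, sub_self, div_zero, abs_zero]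
      positivity
    · have hwy := hwpos y h
      have h1 : 0 < 1 - |y| := by linarith
      have e : spow r y - q / p * spow q y * f y =
          (spow r y - spow q y) - q / p * spow q y * (f y - p / q) := by
        field_simp
        ring
      have hs : |spow q y| ≤ 1 := by
        rw [abs_spow hq]; exact Real.rpow_le_one (abs_nonneg y) hy (by linarith)
      have b1 := abs_spow_sub_spow_le hr hq hy
      have b2 : |q / p * spow q y * (f y - p / q)| ≤ q / p * 1 * (C1 * (1 - |y|)) := by
        rw [abs_mul, abs_mul, abs_of_pos (by positivity : 0 < q / p)]
        gcongr
        exact hnear y hy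
      have b3 : |spow r y - q / p * spow q y * f y| ≤ (r + q + q / p * C1) * (1 - |y|) := by
        rw [e]
        refine (abs_sub _ _).trans ?_
        linarith
      simp only [hf']
      rw [abs_div, abs_of_pos (show 0 < 1 - |y| ^ q from hwy), div_le_iff₀ hwy]
      refine b3.trans ?_
      have : 0 ≤ q / p * C1 := by positivity
      exact mul_le_mul (by linarith) (hwge y hy) h1.le (by positivity)

/-! ### A direction of negative second variation -/

namespace IsProfile

variable {p q r C : ℝ} {f f' : ℝ → ℝ}

lemma mul_deriv (hq : 1 < q) (hf : IsProfile p q r C f f') {y : ℝ} (hy : |y| < 1) :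
    (1 - |y| ^ q) * f' y = spow r y - q / p * spow q y * f y := by
  rw [hf.deriv_eq, mul_div_cancel₀ _ (one_sub_abs_rpow_pos hq hy).ne']

lemma continuousAt_deriv (hq : 1 < q) (hr : 1 < r) (hf : IsProfile p q r C f f') {y : ℝ}
    (hy : |y| < 1) : ContinuousAt f' y := by
  have e : f' = fun y => (spow r y - q / p * spow q y * f y) / (1 - |y| ^ q) :=
    funext hf.deriv_eq
  rw [e]
  refine ContinuousAt.div ?_ ?_ (one_sub_abs_rpow_pos hq hy).ne'
  · exact (continuous_spow hr).continuousAt.sub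
      ((continuousAt_const.mul (continuous_spow hq).continuousAt).mul
        (hf.hasDerivAt y hy).continuousAt)
  · exact continuousAt_const.sub (hasDerivAt_abs_rpow_spow hq y).continuousAt

lemma hasDerivAt_deriv (hp : 1 < p) (hq : 1 < q) (hf : IsProfile p q r C f f') {y : ℝ}
    (hy : |y| < 1) (hy0 : y ≠ 0) :
    HasDerivAt f' (((r - 1) * |y| ^ (r - 2) - q / p * (q - 1) * |y| ^ (q - 2) * f y +
      (q - q / p) * spow q y * f' y) / (1 - |y| ^ q)) y := by
  have hw := (one_sub_abs_rpow_pos hq hy).ne'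
  have d1 := (hasDerivAt_spow r hy0).sub
    (((hasDerivAt_spow q hy0).const_mul (q / p)).mul (hf.hasDerivAt y hy))
  have d2 := d1.div ((hasDerivAt_abs_rpow_spow hq y).const_sub 1) hw
  have e : f' = fun y => (spow r y - q / p * spow q y * f y) / (1 - |y| ^ q) :=
    funext hf.deriv_eq
  nth_rewrite 1 [e]
  refine d2.congr_deriv ?_
  have e2 := hf.mul_deriv hq hy
  simp only [Pi.sub_apply, Pi.mul_apply]
  rw [← e2]
  field_simp
  ring

lemma f_one (hf : IsProfile p q r C f f') {y : ℝ} (hy : |y| = 1) : f y = p / q := by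
  have := hf.near_one y hy.le
  rw [hy, sub_self, mul_zero] at this
  linarith [abs_nonpos_iff.1 this]

end IsProfile

namespace Extremal

variable {p q r C κ a b : ℝ} {u u' f f' : ℝ → ℝ}

lemma abs_lt_one (hp : 1 < p) (hq : 1 < q) (h : Extremal p q κ a b u u') {x : ℝ}
    (hx : x ∈ Icc a b) (hux : u' x ≠ 0) : |u x| < 1 :=
  lt_of_le_of_ne (h.abs_le_one hp hq hx) fun h1 => hux ((h.deriv_eq_zero_iff hp hq hx).2 h1)

/-- `f' ∘ u` is discontinuous at critical points of `u`, but bounded: it becomes continuous when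
multiplied with a continuous function that vanishes there. -/
lemma continuousOn_deriv_comp_mul (hp : 1 < p) (hq : 1 < q) (hr : 1 < r)
    (h : Extremal p q κ a b u u') (hf : IsProfile p q r C f f') {g : ℝ → ℝ}
    (hg : ContinuousOn g (Icc a b)) (hg0 : ∀ x ∈ Icc a b, u' x = 0 → g x = 0) :
    ContinuousOn (fun x => f' (u x) * g x) (Icc a b) := by
  intro x hx
  by_cases hux : u' x = 0
  · have h0 : f' (u x) * g x = 0 := by rw [hg0 x hx hux, mul_zero]
    rw [ContinuousWithinAt, h0]
    have hlim : Tendsto (fun y => C * |g y|) (𝓝[Icc a b] x) (𝓝 0) := by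
      have := ((hg x hx).abs.const_mul C).tendsto
      rwa [hg0 x hx hux, abs_zero, mul_zero] at this
    refine squeeze_zero_norm' ?_ hlim
    filter_upwards [self_mem_nhdsWithin] with y hy
    rw [Real.norm_eq_abs, abs_mul]
    exact mul_le_mul_of_nonneg_right (hf.deriv_le _ (h.abs_le_one hp hq hy)) (abs_nonneg _)
  · exact ((hf.continuousAt_deriv hq hr (h.abs_lt_one hp hq hx hux)).comp_continuousWithinAt
      (h.c1On.continuousOn x hx)).mul (hg x hx)

/-- At critical points of `u` the derivative vanishes because `f` is Lipschitz at `±1`. -/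
lemma c1On_comp (hp : 1 < p) (hq : 1 < q) (hr : 1 < r) (h : Extremal p q κ a b u u')
    (hf : IsProfile p q r C f f') :
    C1On a b (fun x => f (u x)) (fun x => f' (u x) * u' x) := by
  refine ⟨h.continuousOn_deriv_comp_mul hp hq hr hf h.c1On.continuousOn_deriv
    fun _ _ h0 => h0, fun x hx => ?_⟩
  by_cases hux : u' x = 0
  · have h1 := (h.deriv_eq_zero_iff hp hq hx).1 hux
    have hd := h.c1On.hasDerivWithinAt x hx
    rw [hux] at hd ⊢
    rw [mul_zero, hasDerivWithinAt_iff_isLittleO]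
    rw [hasDerivWithinAt_iff_isLittleO] at hd
    simp only [smul_zero, sub_zero] at hd ⊢
    refine IsBigO.trans_isLittleO ?_ hd
    refine IsBigO.of_bound C ?_
    filter_upwards [self_mem_nhdsWithin] with y hy
    rw [hf.f_one h1, Real.norm_eq_abs, Real.norm_eq_abs]
    have hC : 0 ≤ C := (abs_nonneg _).trans (hf.deriv_le _ (h.abs_le_one hp hq hx))
    refine (hf.near_one _ (h.abs_le_one hp hq hy)).trans ?_
    gcongr
    rw [← h1, abs_sub_comm]
    exact abs_sub_abs_le_abs_sub _ _
  · exact (hf.hasDerivAt _ (h.abs_lt_one hp hq hx hux)).comp_hasDerivWithinAt x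
      (h.c1On.hasDerivWithinAt x hx)

/-- The linearized Euler-Lagrange equation satisfied by `f ∘ u`, with a multiplier. -/
lemma hasDerivAt_momentum (hp : 1 < p) (hq : 1 < q) (h : Extremal p q κ a b u u')
    (hf : IsProfile p q r C f f') {x : ℝ} (hx : x ∈ Ioo a b) (hux : u x ≠ 0) (hux' : u' x ≠ 0) :
    HasDerivAt (fun x => f' (u x) * spow p (u' x))
      (κ * p / (q * (p - 1)) * (r - 1) * |u x| ^ (r - 2) -
        κ * (q - 1) / (p - 1) * (|u x| ^ (q - 2) * f (u x))) x := by
  have hxI := Ioo_subset_Icc_self hx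
  have hlt := h.abs_lt_one hp hq hxI hux'
  have hw := (one_sub_abs_rpow_pos hq hlt).ne'
  have d := ((hf.hasDerivAt_deriv hp hq hlt hux).comp x (h.c1On.hasDerivAt hx)).mul
    (h.euler.hasDerivAt hx)
  refine d.congr_deriv ?_
  have e1 : u' x * spow p (u' x) = κ * p / (q * (p - 1)) * (1 - |u x| ^ q) := by
    rw [← h.energy x hxI, mul_comm, spow_mul_self (by linarith)]
  have e2 : ∀ z : ℝ, z / (1 - |u x| ^ q) * u' x * spow p (u' x) =
      κ * p / (q * (p - 1)) * z := fun z => by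
    rw [mul_assoc, e1]; field_simp
  rw [e2]
  have hp0 : p ≠ 0 := by linarith
  have hq0 : q ≠ 0 := by linarith
  have hp1 : p - 1 ≠ 0 := by linarith
  simp only [Function.comp_apply]
  field_simp
  ring

lemma spow_deriv_endpoints (hp : 1 < p) (hq : 1 < q) (h : Extremal p q κ a b u u') :
    spow p (u' a) = 0 ∧ spow p (u' b) = 0 := by
  rw [(h.deriv_eq_zero_iff hp hq (left_mem_Icc.2 h.lt.le)).2 h.abs_left,
    (h.deriv_eq_zero_iff hp hq (right_mem_Icc.2 h.lt.le)).2 h.abs_right]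
  simp

lemma intervalIntegrable_mul (hp : 1 < p) (hq : 1 < q) (h : Extremal p q κ a b u u') {e : ℝ}
    (he : -1 < e) {g : ℝ → ℝ} (hg : ContinuousOn g (Icc a b)) :
    IntervalIntegrable (fun x => |u x| ^ e * g x) MeasureTheory.volume a b :=
  (h.intervalIntegrable hp hq he).mul_continuousOn (by rwa [uIcc_of_le h.lt.le])

/-- Fundamental theorem of calculus away from zeros and critical points of `u`. -/
lemma integral_eq_sub (hp : 1 < p) (hq : 1 < q) (h : Extremal p q κ a b u u') {g g' : ℝ → ℝ}
    (hg : ContinuousOn g (Icc a b))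
    (hd : ∀ x ∈ Ioo a b, u x ≠ 0 → u' x ≠ 0 → HasDerivAt g (g' x) x)
    (hi : IntervalIntegrable g' MeasureTheory.volume a b) :
    ∫ x in a..b, g' x = g b - g a := by
  refine MeasureTheory.integral_eq_of_hasDerivAt_off_countable_of_le g g' h.lt.le
    (h.finite_exceptional hp hq).countable hg (fun x hx => ?_) hi
  have hxI := Ioo_subset_Icc_self hx.1
  exact hd x hx.1 (fun h0 => hx.2 ⟨hxI, Or.inl h0⟩) (fun h0 => hx.2 ⟨hxI, Or.inr h0⟩)

lemma continuousOn_momentum (hp : 1 < p) (hq : 1 < q) (hr : 1 < r)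
    (h : Extremal p q κ a b u u') (hf : IsProfile p q r C f f') :
    ContinuousOn (fun x => f' (u x) * spow p (u' x)) (Icc a b) :=
  h.continuousOn_deriv_comp_mul hp hq hr hf h.euler.continuousOn
    fun x _ h0 => by rw [h0, spow_zero]

/-- The linearized equation tested with `1`. -/
lemma integral_linearized (hp : 1 < p) (hq : 1 < q) (hr : 1 < r)
    (h : Extremal p q κ a b u u') (hf : IsProfile p q r C f f') :
    κ * p / (q * (p - 1)) * (r - 1) * ∫ x in a..b, |u x| ^ (r - 2) =
      κ * (q - 1) / (p - 1) * ∫ x in a..b, |u x| ^ (q - 2) * f (u x) := by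
  have i1 := (h.intervalIntegrable hp hq (by linarith : -1 < r - 2)).const_mul
    (κ * p / (q * (p - 1)) * (r - 1))
  have i2 := (h.intervalIntegrable_mul hp hq (by linarith : -1 < q - 2)
    (h.c1On_comp hp hq hr hf).continuousOn).const_mul (κ * (q - 1) / (p - 1))
  have := h.integral_eq_sub hp hq (h.continuousOn_momentum hp hq hr hf)
    (fun x hx h1 h2 => h.hasDerivAt_momentum hp hq hf hx h1 h2) (i1.sub i2)
  rw [intervalIntegral.integral_sub i1 i2, intervalIntegral.integral_const_mul,
    intervalIntegral.integral_const_mul, (h.spow_deriv_endpoints hp hq).1,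
    (h.spow_deriv_endpoints hp hq).2] at this
  linarith

/-- The linearized equation tested with `f ∘ u`. -/
lemma integral_linearized_mul (hp : 1 < p) (hq : 1 < q) (hr : 1 < r)
    (h : Extremal p q κ a b u u') (hf : IsProfile p q r C f f') :
    ∫ x in a..b, |u' x| ^ p * f' (u x) ^ 2 =
      κ * (q - 1) / (p - 1) * (∫ x in a..b, |u x| ^ (q - 2) * f (u x) ^ 2) -
      κ * p / (q * (p - 1)) * (r - 1) * ∫ x in a..b, |u x| ^ (r - 2) * f (u x) := by
  have hφ := h.c1On_comp hp hq hr hf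
  have i1 := (h.intervalIntegrable_mul hp hq (by linarith : -1 < r - 2)
    hφ.continuousOn).const_mul (κ * p / (q * (p - 1)) * (r - 1))
  have i2 : IntervalIntegrable (fun x => κ * (q - 1) / (p - 1) * (|u x| ^ (q - 2) * f (u x) ^ 2))
      MeasureTheory.volume a b := (h.intervalIntegrable_mul hp hq (by linarith : -1 < q - 2)
    (hφ.continuousOn.pow 2)).const_mul (κ * (q - 1) / (p - 1))
  have e3 : ∀ x, |u' x| ^ p * f' (u x) ^ 2 =
      f' (u x) * spow p (u' x) * (f' (u x) * u' x) := fun x => by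
    rw [← spow_mul_self (by linarith : p ≠ 0)]; ring
  have i3 : IntervalIntegrable (fun x => |u' x| ^ p * f' (u x) ^ 2) MeasureTheory.volume a b := by
    simp only [e3]
    exact ((h.continuousOn_momentum hp hq hr hf).mul
      hφ.continuousOn_deriv).intervalIntegrable_of_Icc h.lt.le
  have := h.integral_eq_sub hp hq ((h.continuousOn_momentum hp hq hr hf).mul hφ.continuousOn)
    (g' := fun x => κ * p / (q * (p - 1)) * (r - 1) * (|u x| ^ (r - 2) * f (u x)) -
      κ * (q - 1) / (p - 1) * (|u x| ^ (q - 2) * f (u x) ^ 2) + |u' x| ^ p * f' (u x) ^ 2)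
    (fun x hx h1 h2 => ((h.hasDerivAt_momentum hp hq hf hx h1 h2).mul
      (hφ.hasDerivAt hx)).congr_deriv (by rw [e3]; ring)) ((i1.sub i2).add i3)
  rw [intervalIntegral.integral_add (i1.sub i2) i3, intervalIntegral.integral_sub i1 i2,
    intervalIntegral.integral_const_mul, intervalIntegral.integral_const_mul, Pi.mul_apply,
    Pi.mul_apply, (h.spow_deriv_endpoints hp hq).1, (h.spow_deriv_endpoints hp hq).2] at this
  linarith

/-- The integral of a function that is positive away from zeros and critical points is positive. -/
lemma integral_pos (hp : 1 < p) (hq : 1 < q) (h : Extremal p q κ a b u u') {g : ℝ → ℝ}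
    (hi : IntervalIntegrable g MeasureTheory.volume a b) (h0 : ∀ x ∈ Icc a b, 0 ≤ g x)
    (hpos : ∀ x ∈ Icc a b, u x ≠ 0 → u' x ≠ 0 → 0 < g x) : 0 < ∫ x in a..b, g x := by
  have hF := h.finite_exceptional hp hq
  have hnn : 0 ≤ᵐ[MeasureTheory.volume.restrict (Ioc a b)] g :=
    (MeasureTheory.ae_restrict_iff' measurableSet_Ioc).2
      (Eventually.of_forall fun x hx => h0 x (Ioc_subset_Icc_self hx))
  rw [intervalIntegral.integral_pos_iff_support_of_nonneg_ae'
    (by rwa [uIoc_of_le h.lt.le]) hi]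
  refine ⟨h.lt, lt_of_lt_of_le ?_ (MeasureTheory.measure_mono (?_ :
    Ioc a b \ {x ∈ Icc a b | u x = 0 ∨ u' x = 0} ⊆ _))⟩
  · rw [MeasureTheory.measure_sdiff_null (hF.measure_zero _), Real.volume_Ioc]
    simpa using h.lt
  · rintro x ⟨hx, hx'⟩
    have hxI := Ioc_subset_Icc_self hx
    refine ⟨(hpos x hxI ?_ ?_).ne', hx⟩
    · exact fun h1 => hx' ⟨hxI, Or.inl h1⟩
    · exact fun h1 => hx' ⟨hxI, Or.inr h1⟩

/-- The integral vanishes for `q = (2 r - 1) p`, and this is where the threshold comes from: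
`(r - 1) |u|^(r-2) f(u)` differs by an exact derivative from
`(|u|^(q/p-1) - |u|^(2r-2)) / (1 - |u|^q)`. -/
lemma integral_constraint_neg (hp : 1 < p) (hq : 1 < q) (hr : 1 < r)
    (hpqr : (2 * r - 1) * p < q) (h : Extremal p q κ a b u u') (hf : IsProfile p q r C f f') :
    ∫ x in a..b, |u x| ^ (r - 2) * f (u x) < 0 := by
  have hp0 : 0 < p := by linarith
  have hq0 : 0 < q := by linarith
  have hqp : 2 * r - 1 < q / p := by rwa [lt_div_iff₀ hp0]
  have hs : 1 < q / p + 1 := by linarith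
  have hρ := h.coeff_pos hp hq
  set ρ := κ * p / (q * (p - 1)) with hρdef
  have hφ := h.c1On_comp hp hq hr hf
  have hab := h.lt.le
  have hC : 0 ≤ C := (abs_nonneg _).trans
    (hf.deriv_le _ (h.abs_le_one hp hq (left_mem_Icc.2 hab)))
  have hw0 : ∀ x ∈ Icc a b, 0 ≤ 1 - |u x| ^ q := fun x hx => by
    have := Real.rpow_le_one (abs_nonneg _) (h.abs_le_one hp hq hx) hq0.le
    linarith
  have hwge : ∀ x ∈ Icc a b, 1 - |u x| ≤ 1 - |u x| ^ q := fun x hx => by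
    linarith [abs_rpow_le_self hq (h.abs_le_one hp hq hx)]
  -- `B` is the term that the threshold makes positive, `num / u'` the function to be differentiated
  set B : ℝ → ℝ := fun x => (|u x| ^ (2 * r - 2) - |u x| ^ (q / p - 1)) / (1 - |u x| ^ q) with hB
  set num : ℝ → ℝ := fun x => spow r (u x) * f (u x) - p / q * spow (q / p + 1) (u x) with hnum
  have hB0 : ∀ x ∈ Icc a b, 0 ≤ B x := fun x hx => by
    refine div_nonneg ?_ (hw0 x hx)
    rw [sub_nonneg]
    exact Real.rpow_le_rpow_of_exponent_ge_of_imp (abs_nonneg _) (h.abs_le_one hp hq hx)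
      (by linarith) fun _ h0 => by linarith
  have hBpos : ∀ x ∈ Icc a b, u x ≠ 0 → u' x ≠ 0 → 0 < B x := fun x hx h1 h2 => by
    have hlt := h.abs_lt_one hp hq hx h2
    refine div_pos ?_ (one_sub_abs_rpow_pos hq hlt)
    rw [sub_pos]
    exact Real.rpow_lt_rpow_of_exponent_gt (abs_pos.2 h1) hlt (by linarith)
  have hBi : IntervalIntegrable B MeasureTheory.volume a b := by
    rw [intervalIntegrable_iff_integrableOn_Icc_of_le hab]
    have hu : AEMeasurable (fun x => |u x|) (MeasureTheory.volume.restrict (Icc a b)) :=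
      h.c1On.continuousOn.abs.aemeasurable measurableSet_Icc
    refine MeasureTheory.Integrable.mono' (g := fun _ => 2 + (2 * r - 2) + (q / p - 1))
      (MeasureTheory.integrableOn_const (by simp) ) ?_ ?_
    · exact (((hu.pow_const _).sub (hu.pow_const _)).div
        ((hu.pow_const _).const_sub 1)).aestronglyMeasurable
    · refine (MeasureTheory.ae_restrict_iff' measurableSet_Icc).2
        (Eventually.of_forall fun x hx => ?_)
      have h1 := abs_rpow_sub_rpow_le (abs_nonneg (u x)) (h.abs_le_one hp hq hx)
        (by linarith : 0 ≤ 2 * r - 2) (by linarith : 0 ≤ q / p - 1)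
      rw [Real.norm_eq_abs, hB, abs_div, abs_of_nonneg (hw0 x hx)]
      refine div_le_of_le_mul₀ (hw0 x hx) (by linarith) (h1.trans ?_)
      exact mul_le_mul_of_nonneg_left (hwge x hx) (by linarith)
  have hnumle : ∀ x ∈ Icc a b, |num x| ≤ (C + p / q * (r + (q / p + 1))) * (1 - |u x|) :=
    fun x hx => by
    have hle := h.abs_le_one hp hq hx
    have e : num x = spow r (u x) * (f (u x) - p / q) +
        p / q * (spow r (u x) - spow (q / p + 1) (u x)) := by simp only [hnum]; ring
    have b1 : |spow r (u x)| ≤ 1 := by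
      rw [abs_spow hr]; exact Real.rpow_le_one (abs_nonneg _) hle (by linarith)
    have b2 := hf.near_one _ hle
    have b3 := abs_spow_sub_spow_le hr hs hle
    rw [e]
    refine (abs_add_le _ _).trans ?_
    rw [abs_mul, abs_mul, abs_of_pos (by positivity : 0 < p / q)]
    have : |spow r (u x)| * |f (u x) - p / q| ≤ 1 * (C * (1 - |u x|)) := by gcongr
    have : p / q * |spow r (u x) - spow (q / p + 1) (u x)| ≤
      p / q * ((r + (q / p + 1)) * (1 - |u x|)) := by gcongr
    linarith
  have hnumc : ContinuousOn num (Icc a b) :=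
    (((continuous_spow hr).comp_continuousOn h.c1On.continuousOn).mul hφ.continuousOn).sub
      (continuousOn_const.mul ((continuous_spow hs).comp_continuousOn h.c1On.continuousOn))
  -- at critical points of `u` the quotient is `0` by convention, which is also its limit
  have hquot : ContinuousOn (fun x => num x / u' x) (Icc a b) := by
    intro x hx
    by_cases hux : u' x = 0
    · rw [ContinuousWithinAt, hux, div_zero]
      set D := (C + p / q * (r + (q / p + 1))) / ρ with hD
      have hlim : Tendsto (fun y => D * |u' y| ^ (p - 1)) (𝓝[Icc a b] x) (𝓝 0) := by
        have := (((h.c1On.continuousOn_deriv x hx).abs.rpow_const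
          (p := p - 1) (Or.inr (by linarith))).const_mul D).tendsto
        rwa [hux, abs_zero, Real.zero_rpow (by linarith), mul_zero] at this
      refine squeeze_zero_norm' ?_ hlim
      filter_upwards [self_mem_nhdsWithin] with y hy
      rw [Real.norm_eq_abs, abs_div]
      have hrp : 0 ≤ r + (q / p + 1) := by linarith
      have hcoef : 0 ≤ C + p / q * (r + (q / p + 1)) := by positivity
      have hD0 : 0 ≤ D := div_nonneg hcoef hρ.le
      rcases eq_or_ne (u' y) 0 with h0 | h0
      · rw [h0, abs_zero, div_zero]
        exact mul_nonneg hD0 (Real.rpow_nonneg le_rfl _)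
      · rw [div_le_iff₀ (abs_pos.2 h0), mul_assoc]
        have e : |u' y| ^ (p - 1) * |u' y| = |u' y| ^ p := by
          rw [Real.rpow_sub_one (abs_pos.2 h0).ne', div_mul_cancel₀ _ (abs_pos.2 h0).ne']
        rw [e, h.energy y hy, ← hρdef, hD, ← mul_assoc, div_mul_cancel₀ _ hρ.ne']
        exact (hnumle y hy).trans (mul_le_mul_of_nonneg_left (hwge y hy) hcoef)
    · exact (hnumc x hx).div (h.c1On.continuousOn_deriv x hx) hux
  -- the derivative of `u'` itself exists away from the critical points
  have hu'' : ∀ x ∈ Ioo a b, u' x ≠ 0 →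
      HasDerivAt u' (-(q / p) * spow q (u x) * u' x ^ 2 / (1 - |u x| ^ q)) x := by
    intro x hx h2
    have hxI := Ioo_subset_Icc_self hx
    have hp1 : 0 < p - 1 := by linarith
    have hconj : (p - 1) * (p / (p - 1) - 1) = 1 := by field_simp; ring
    have hm0 : spow p (u' x) ≠ 0 := by
      rw [← abs_ne_zero, abs_spow hp]
      exact (Real.rpow_pos_of_pos (abs_pos.2 h2) _).ne'
    have d := (hasDerivAt_spow (p / (p - 1)) hm0).comp x (h.euler.hasDerivAt hx)
    have e : spow (p / (p - 1)) ∘ (fun x => spow p (u' x)) = u' := by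
      funext y; exact spow_spow hconj _
    rw [e] at d
    refine d.congr_deriv ?_
    have hpos : 0 < |u' x| := abs_pos.2 h2
    have e1 : |spow p (u' x)| ^ (p / (p - 1) - 2) = u' x ^ 2 / |u' x| ^ p := by
      rw [abs_spow hp, ← Real.rpow_mul hpos.le, ← sq_abs, ← Real.rpow_natCast,
        ← Real.rpow_sub hpos]
      congr 1
      push_cast
      field_simp
      ring
    have hw := (one_sub_abs_rpow_pos hq (h.abs_lt_one hp hq hxI h2)).ne'
    have hκ := h.pos.ne'
    rw [e1, h.energy x hxI]
    field_simp
    ring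
  have hd : ∀ x ∈ Ioo a b, u x ≠ 0 → u' x ≠ 0 →
      HasDerivAt (fun x => num x / u' x) ((r - 1) * (|u x| ^ (r - 2) * f (u x)) + B x) x := by
    intro x hx h1 h2
    have hxI := Ioo_subset_Icc_self hx
    have hlt := h.abs_lt_one hp hq hxI h2
    have hw := (one_sub_abs_rpow_pos hq hlt).ne'
    have du := h.c1On.hasDerivAt hx
    have d1 := (((hasDerivAt_spow r h1).comp x du).mul (hφ.hasDerivAt hx)).sub
      (((hasDerivAt_spow (q / p + 1) h1).comp x du).const_mul (p / q))
    refine (d1.div (hu'' x hx h2) h2).congr_deriv ?_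
    have e1 : q / p + 1 - 2 = q / p - 1 := by ring
    have e2 : spow r (u x) * spow r (u x) = |u x| ^ (2 * r - 2) := by
      rw [spow_mul_spow hr hr]; congr 1; ring
    have e3 : spow q (u x) * spow (q / p + 1) (u x) = |u x| ^ q * |u x| ^ (q / p - 1) := by
      rw [spow_mul_spow hq hs, ← Real.rpow_add (abs_pos.2 h1)]
      congr 1; ring
    have e5 : f' (u x) = (spow r (u x) - q / p * spow q (u x) * f (u x)) / (1 - |u x| ^ q) :=
      hf.deriv_eq _
    simp only [hB, Function.comp_apply, Pi.sub_apply, Pi.mul_apply]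
    rw [e1, e5, ← e2, add_sub_cancel_right]
    generalize |u x| ^ (q / p - 1) = W at e3 ⊢
    generalize spow (q / p + 1) (u x) = Z at e3 ⊢
    field_simp
    linear_combination -p * e3
  have i1 := (h.intervalIntegrable_mul hp hq (by linarith : -1 < r - 2)
    hφ.continuousOn).const_mul (r - 1)
  have key := h.integral_eq_sub hp hq hquot hd (i1.add hBi)
  rw [intervalIntegral.integral_add i1 hBi, intervalIntegral.integral_const_mul,
    (h.deriv_eq_zero_iff hp hq (left_mem_Icc.2 hab)).2 h.abs_left,
    (h.deriv_eq_zero_iff hp hq (right_mem_Icc.2 hab)).2 h.abs_right, div_zero, div_zero,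
    sub_zero] at key
  have := h.integral_pos hp hq hBi hB0 hBpos
  by_contra! hcon
  have : 0 ≤ (r - 1) * ∫ x in a..b, |u x| ^ (r - 2) * f (u x) :=
    mul_nonneg (by linarith) hcon
  linarith

/-- Above the threshold some even direction `ζ`, tangent to the constraint, has negative second
variation. The derivative is written as `k u'` with `k` bounded, which makes the second variation
finite for all exponents. -/
lemma exists_negative_direction (hp : 1 < p) (hq : 1 < q) (hr : 1 < r)
    (hpqr : (2 * r - 1) * p < q) (h : Extremal p q κ a b u u')
    (hodd : ∀ x ∈ Icc a b, u (a + b - x) = -u x) :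
    ∃ (ζ k : ℝ → ℝ) (C : ℝ), C1On a b ζ (fun x => k x * u' x) ∧
      (∀ x ∈ Icc a b, ζ (a + b - x) = ζ x) ∧ (∀ x ∈ Icc a b, |k x| ≤ C) ∧
      ∫ x in a..b, |u x| ^ (r - 2) * ζ x = 0 ∧
      (p - 1) * ∫ x in a..b, |u' x| ^ p * k x ^ 2 <
        κ * ((q - 1) * ∫ x in a..b, |u x| ^ (q - 2) * ζ x ^ 2) := by
  obtain ⟨C, f, f', -, hf⟩ := exists_profile (r := r) hp hq hr
  have hφ := h.c1On_comp hp hq hr hf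
  have hK := h.integral_constraint_neg hp hq hr hpqr hf
  have hA := h.integral_linearized hp hq hr hf
  have hB := h.integral_linearized_mul hp hq hr hf
  have hpw : ∀ e x : ℝ, u x ≠ 0 → 0 < |u x| ^ e := fun e x h0 =>
    Real.rpow_pos_of_pos (abs_pos.2 h0) e
  have i0 := h.intervalIntegrable hp hq (by linarith : -1 < r - 2)
  have j0 := h.intervalIntegrable hp hq (by linarith : -1 < q - 2)
  have i1 := h.intervalIntegrable_mul hp hq (by linarith : -1 < r - 2) hφ.continuousOn
  have j1 := h.intervalIntegrable_mul hp hq (by linarith : -1 < q - 2) hφ.continuousOn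
  have j2 : IntervalIntegrable (fun x => |u x| ^ (q - 2) * f (u x) ^ 2) MeasureTheory.volume a b :=
    h.intervalIntegrable_mul hp hq (by linarith : -1 < q - 2) (hφ.continuousOn.pow 2)
  have hk0 : 0 < ∫ x in a..b, |u x| ^ (r - 2) := h.integral_pos hp hq i0
    (fun x _ => Real.rpow_nonneg (abs_nonneg _) _) fun x _ h1 _ => hpw _ x h1
  have hq0 : 0 < ∫ x in a..b, |u x| ^ (q - 2) := h.integral_pos hp hq j0
    (fun x _ => Real.rpow_nonneg (abs_nonneg _) _) fun x _ h1 _ => hpw _ x h1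
  set K := ∫ x in a..b, |u x| ^ (r - 2) * f (u x) with hKdef
  set k0 := ∫ x in a..b, |u x| ^ (r - 2) with hk0def
  set Φ0 := ∫ x in a..b, |u x| ^ (q - 2)
  set Φ1 := ∫ x in a..b, |u x| ^ (q - 2) * f (u x)
  set Φ2 := ∫ x in a..b, |u x| ^ (q - 2) * f (u x) ^ 2
  -- the constant that makes `f(u) + c` tangent to the constraint
  set c := -K / k0 with hc
  have hck : c * k0 = -K := div_mul_cancel₀ _ hk0.ne'
  have hc0 : 0 < c := div_pos (by linarith) hk0
  refine ⟨fun x => f (u x) + c, fun x => f' (u x), C, ?_, ?_, ?_, ?_, ?_⟩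
  · have := hφ.add (C1On.const a b c)
    simpa using this
  · intro x hx
    simp only [hodd x hx, hf.even _ (h.abs_le_one hp hq hx)]
  · exact fun x hx => hf.deriv_le _ (h.abs_le_one hp hq hx)
  · have e : ∀ x, |u x| ^ (r - 2) * (f (u x) + c) =
        |u x| ^ (r - 2) * f (u x) + c * |u x| ^ (r - 2) := fun x => by ring
    simp only [e]
    rw [intervalIntegral.integral_add i1 (i0.const_mul c), intervalIntegral.integral_const_mul,
      hck, add_neg_cancel]
  · have e : ∀ x, |u x| ^ (q - 2) * (f (u x) + c) ^ 2 = |u x| ^ (q - 2) * f (u x) ^ 2 +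
        2 * c * (|u x| ^ (q - 2) * f (u x)) + c ^ 2 * |u x| ^ (q - 2) := fun x => by ring
    simp only [e]
    rw [intervalIntegral.integral_add (j2.add (j1.const_mul _)) (j0.const_mul _),
      intervalIntegral.integral_add j2 (j1.const_mul _), intervalIntegral.integral_const_mul,
      intervalIntegral.integral_const_mul, hB]
    have hp1 : p - 1 ≠ 0 := by linarith
    have hρ := h.coeff_pos hp hq
    set ρ := κ * p / (q * (p - 1))
    have h1 : 0 < κ * (q - 1) * (c ^ 2 * Φ0) := by
      have := h.pos
      have : 0 < q - 1 := by linarith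
      positivity
    have h2 : κ * (q - 1) * Φ1 = (p - 1) * (ρ * (r - 1) * k0) := by
      rw [hA]; field_simp
    have h3 : (p - 1) * (κ * (q - 1) / (p - 1) * Φ2 - ρ * (r - 1) * K) =
        κ * (q - 1) * Φ2 - (p - 1) * ρ * (r - 1) * K := by field_simp
    have h4 : κ * (q - 1) * (2 * c * Φ1) = -(2 * ((p - 1) * ρ * (r - 1) * K)) := by
      linear_combination 2 * c * h2 + 2 * (p - 1) * ρ * (r - 1) * hck
    have h5 : 0 < -((p - 1) * ρ * (r - 1) * K) := by
      have h6 : 0 < p - 1 := by linarith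
      have h7 : 0 < r - 1 := by linarith
      have h8 : 0 < -K := by linarith
      have : 0 < (p - 1) * ρ * (r - 1) * (-K) := by positivity
      linarith
    rw [h3]
    linarith

end Extremal

/-! ### The second variation -/

/-- Second-order expansion along directions `h ε` that vary with `ε`. -/
lemma tendsto_secondDiff_div {q : ℝ} (hq : 1 < q) {a : ℝ} (ha : a ≠ 0) {h : ℝ → ℝ} {h₀ : ℝ}
    (hh : Tendsto h (𝓝[>] 0) (𝓝 h₀)) :
    Tendsto (fun ε => secondDiff q a (ε * h ε) / ε ^ 2) (𝓝[>] 0)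
      (𝓝 (q * (q - 1) * |a| ^ (q - 2) * h₀ ^ 2)) := by
  have hid : Tendsto (fun ε : ℝ => ε) (𝓝[>] 0) (𝓝 0) :=
    tendsto_nhdsWithin_of_tendsto_nhds tendsto_id
  have ht : Tendsto (fun ε => ε * h ε) (𝓝[>] 0) (𝓝 0) := by
    simpa using hid.mul hh
  have ho := (secondDiff_sub_isLittleO hq ha).comp_tendsto ht
  have hO : (fun ε => (ε * h ε) ^ 2) =O[𝓝[>] 0] fun ε => ε ^ 2 := by
    have h1 : h =O[𝓝[>] 0] fun _ => (1 : ℝ) := hh.isBigO_one ℝ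
    have h2 := ((isBigO_refl (fun ε : ℝ => ε) (𝓝[>] 0)).mul h1).pow 2
    simpa using h2
  have hz := (ho.trans_isBigO hO).tendsto_div_nhds_zero
  have hlim := hz.add ((hh.pow 2).const_mul (q * (q - 1) * |a| ^ (q - 2)))
  rw [zero_add] at hlim
  refine hlim.congr' ?_
  filter_upwards [self_mem_nhdsWithin] with ε hε
  have hε0 : ε ≠ 0 := (mem_Ioi.1 hε).ne'
  simp only [Function.comp_apply]
  field_simp
  ring

lemma aestronglyMeasurable_of_continuousOn {a b : ℝ} (hab : a ≤ b) {g : ℝ → ℝ}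
    (hg : ContinuousOn g (Icc a b)) :
    MeasureTheory.AEStronglyMeasurable g (MeasureTheory.volume.restrict (uIoc a b)) := by
  rw [uIoc_of_le hab]
  exact (hg.mono Ioc_subset_Icc_self).aestronglyMeasurable measurableSet_Ioc

namespace Extremal

variable {p q r κ a b : ℝ} {u u' : ℝ → ℝ}

lemma ae_ne_zero (hp : 1 < p) (hq : 1 < q) (h : Extremal p q κ a b u u') :
    ∀ᵐ x, x ∈ uIoc a b → u x ≠ 0 := by
  have hF := h.finite_exceptional hp hq
  filter_upwards [MeasureTheory.measure_eq_zero_iff_ae_notMem.1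
    (hF.measure_zero MeasureTheory.volume)] with x hx hxI h0
  rw [uIoc_of_le h.lt.le] at hxI
  exact hx ⟨Ioc_subset_Icc_self hxI, Or.inl h0⟩

/-- The derivative of the constraint in a continuous direction. For `r < 2` the integrand
`|u|^(r-2)` is unbounded near the zeros of `u`. -/
lemma tendsto_constraint (hp : 1 < p) (hq : 1 < q) (hr : 1 < r) (h : Extremal p q κ a b u u')
    (h0 : ∫ x in a..b, spow r (u x) = 0) {g : ℝ → ℝ} (hg : ContinuousOn g (Icc a b)) :
    Tendsto (fun ε => (∫ x in a..b, spow r (u x + ε * g x)) / ε) (𝓝[>] 0)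
      (𝓝 ((r - 1) * ∫ x in a..b, |u x| ^ (r - 2) * g x)) := by
  have hab := h.lt.le
  have hu := h.c1On.continuousOn
  obtain ⟨C, hC, hbound⟩ := abs_spow_add_sub_le hr
  have hc : ∀ ε : ℝ, ContinuousOn (fun x => spow r (u x + ε * g x)) (Icc a b) := fun ε =>
    (continuous_spow hr).comp_continuousOn (hu.add (continuousOn_const.mul hg))
  have hc0 : ContinuousOn (fun x => spow r (u x)) (Icc a b) :=
    (continuous_spow hr).comp_continuousOn hu
  have key : Tendsto (fun ε => ∫ x in a..b, (spow r (u x + ε * g x) - spow r (u x)) / ε) (𝓝[>] 0)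
      (𝓝 (∫ x in a..b, (r - 1) * (|u x| ^ (r - 2) * g x))) := by
    refine intervalIntegral.tendsto_integral_filter_of_dominated_convergence
      (fun x => C * ((|u x| ^ (r - 2) + 1) * |g x|)) ?_ ?_ ?_ ?_
    · exact Eventually.of_forall fun ε =>
        aestronglyMeasurable_of_continuousOn hab (((hc ε).sub hc0).div_const ε)
    · filter_upwards [self_mem_nhdsWithin,
        (eventually_abs_mul_le one_pos hg).filter_mono nhdsWithin_le_nhds] with ε hε hεg
      have hε0 : 0 < ε := hε
      filter_upwards [h.ae_ne_zero hp hq] with x hx hxI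
      have hxI' : x ∈ Icc a b := by
        rw [uIoc_of_le hab] at hxI; exact Ioc_subset_Icc_self hxI
      have := hbound (u x) (ε * g x) (hx hxI) (hεg x hxI')
      rw [Real.norm_eq_abs, abs_div, abs_of_pos hε0, div_le_iff₀ hε0]
      refine this.trans (le_of_eq ?_)
      rw [abs_mul, abs_of_pos hε0]
      ring
    · refine IntervalIntegrable.const_mul ?_ C
      exact ((h.intervalIntegrable hp hq (by linarith)).add
        intervalIntegrable_const).mul_continuousOn (by rw [uIcc_of_le hab]; exact hg.abs)
    · filter_upwards [h.ae_ne_zero hp hq] with x hx hxI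
      have hd : HasDerivAt (fun ε : ℝ => spow r (u x + ε * g x))
          ((r - 1) * |u x| ^ (r - 2) * g x) 0 := by
        have h1 : HasDerivAt (fun ε : ℝ => u x + ε * g x) (g x) 0 := by
          simpa using ((hasDerivAt_id (0 : ℝ)).mul_const (g x)).const_add (u x)
        have h2 : HasDerivAt (spow r) ((r - 1) * |u x| ^ (r - 2)) (u x + 0 * g x) := by
          simpa using hasDerivAt_spow r (hx hxI)
        exact h2.comp (0 : ℝ) h1
      have := (hasDerivAt_iff_tendsto_slope_zero.1 hd).mono_left
        (nhdsWithin_mono 0 fun y (hy : 0 < y) => hy.ne')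
      rw [mul_assoc] at this
      refine this.congr fun ε => ?_
      simp [div_eq_inv_mul]
  rw [intervalIntegral.integral_const_mul] at key
  refine key.congr fun ε => ?_
  rw [intervalIntegral.integral_div, intervalIntegral.integral_sub
    ((hc ε).intervalIntegrable_of_Icc hab) (hc0.intervalIntegrable_of_Icc hab), h0, sub_zero]

/-- A direction tangent to the constraint becomes admissible after adding constants `c ε` that
tend to `0`. -/
lemma exists_correction (hp : 1 < p) (hq : 1 < q) (hr : 1 < r) (h : Extremal p q κ a b u u')
    (h0 : ∫ x in a..b, spow r (u x) = 0) {ζ : ℝ → ℝ} (hζ : ContinuousOn ζ (Icc a b))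
    (htan : ∫ x in a..b, |u x| ^ (r - 2) * ζ x = 0) :
    ∃ c : ℝ → ℝ, Tendsto c (𝓝[>] 0) (𝓝 0) ∧
      ∀ᶠ ε in 𝓝[>] 0, ∫ x in a..b, spow r (u x + ε * (ζ x + c ε)) = 0 := by
  have hab := h.lt.le
  have hu := h.c1On.continuousOn
  set G : ℝ → ℝ → ℝ := fun ε c => ∫ x in a..b, spow r (u x + ε * (ζ x + c)) with hG
  have hcont : ∀ ε c : ℝ, ContinuousOn (fun x => spow r (u x + ε * (ζ x + c))) (Icc a b) :=
    fun ε c => (continuous_spow hr).comp_continuousOn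
      (hu.add (continuousOn_const.mul (hζ.add continuousOn_const)))
  have hmono : ∀ ε, 0 < ε → Monotone (G ε) := fun ε hε c d hcd =>
    intervalIntegral.integral_mono_on hab ((hcont ε c).intervalIntegrable_of_Icc hab)
      ((hcont ε d).intervalIntegrable_of_Icc hab) fun x _ =>
        (strictMono_spow hr).monotone (by gcongr)
  have hGc : ∀ ε, Continuous (G ε) := fun ε => by
    obtain ⟨M, hM, huM⟩ := exists_bound hu
    obtain ⟨Z, hZ, hζZ⟩ := exists_bound hζ
    rw [continuous_iff_continuousAt]
    intro c₀
    refine intervalIntegral.continuousAt_of_dominated_interval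
      (bound := fun _ => (M + |ε| * (Z + (|c₀| + 1))) ^ (r - 1)) ?_ ?_ intervalIntegrable_const ?_
    · exact Eventually.of_forall fun c => aestronglyMeasurable_of_continuousOn hab (hcont ε c)
    · filter_upwards [Metric.ball_mem_nhds c₀ one_pos] with c hc
      refine Eventually.of_forall fun x hx => ?_
      rw [uIoc_of_le hab] at hx
      have hxI := Ioc_subset_Icc_self hx
      rw [Real.norm_eq_abs, abs_spow hr]
      refine Real.rpow_le_rpow (abs_nonneg _) ?_ (by linarith)
      rw [Metric.mem_ball, Real.dist_eq] at hc
      have h1 : |c| ≤ |c₀| + 1 := by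
        have := abs_sub_abs_le_abs_sub c c₀
        linarith
      refine (abs_add_le _ _).trans (add_le_add (huM x hxI) ?_)
      rw [abs_mul]
      have h2 := abs_add_le (ζ x) c
      have h3 := hζZ x hxI
      gcongr
      linarith
    · refine Eventually.of_forall fun x _ => ?_
      exact ((continuous_spow hr).comp (by fun_prop :
        Continuous fun c : ℝ => u x + ε * (ζ x + c))).continuousAt
  have hk0 : 0 < ∫ x in a..b, |u x| ^ (r - 2) := h.integral_pos hp hq
    (h.intervalIntegrable hp hq (by linarith)) (fun x _ => Real.rpow_nonneg (abs_nonneg _) _)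
    fun x _ h1 _ => Real.rpow_pos_of_pos (abs_pos.2 h1) _
  have hlim : ∀ η : ℝ, Tendsto (fun ε => G ε η / ε) (𝓝[>] 0)
      (𝓝 ((r - 1) * (η * ∫ x in a..b, |u x| ^ (r - 2)))) := fun η => by
    have h1 := h.tendsto_constraint hp hq hr h0 (hζ.add (continuousOn_const (c := η)))
    have e : ∫ x in a..b, |u x| ^ (r - 2) * (ζ x + η) = η * ∫ x in a..b, |u x| ^ (r - 2) := by
      have e' : ∀ x, |u x| ^ (r - 2) * (ζ x + η) =
        |u x| ^ (r - 2) * ζ x + η * |u x| ^ (r - 2) := fun x => by ring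
      simp only [e']
      rw [intervalIntegral.integral_add (h.intervalIntegrable_mul hp hq (by linarith) hζ)
        ((h.intervalIntegrable hp hq (by linarith)).const_mul η), htan, zero_add,
        intervalIntegral.integral_const_mul]
    simp only [Pi.add_apply] at h1
    rw [e] at h1
    exact h1
  have hsign : ∀ η : ℝ, 0 < η → ∀ᶠ ε in 𝓝[>] 0, 0 < ε ∧ G ε (-η) < 0 ∧ 0 < G ε η := fun η hη => by
    have hr1 : 0 < r - 1 := by linarith
    have h1 : 0 < (r - 1) * (η * ∫ x in a..b, |u x| ^ (r - 2)) := by positivity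
    have h2 : (r - 1) * (-η * ∫ x in a..b, |u x| ^ (r - 2)) < 0 := by
      rw [neg_mul, mul_neg]; linarith
    filter_upwards [self_mem_nhdsWithin, (hlim η).eventually_const_lt h1,
      (hlim (-η)).eventually_lt_const h2] with ε hε h3 h4
    have hε0 : 0 < ε := hε
    refine ⟨hε0, ?_, ?_⟩
    · by_contra! hcon
      exact absurd (div_nonneg hcon hε0.le) (not_le.2 h4)
    · by_contra! hcon
      exact absurd (div_nonpos_of_nonpos_of_nonneg hcon hε0.le) (not_le.2 h3)
  classical
  -- the constraint is monotone in the constant, so that its zero lies in every `(-η, η)` eventually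
  set c : ℝ → ℝ := fun ε => if hz : ∃ c, G ε c = 0 then hz.choose else 0 with hc
  have hzero : ∀ᶠ ε in 𝓝[>] 0, G ε (c ε) = 0 := by
    filter_upwards [hsign 1 one_pos] with ε hε
    have hex : ∃ c, G ε c = 0 := by
      obtain ⟨d, -, hd⟩ := intermediate_value_Icc (by norm_num : (-1 : ℝ) ≤ 1)
        (hGc ε).continuousOn ⟨hε.2.1.le, hε.2.2.le⟩
      exact ⟨d, hd⟩
    simp only [hc, dif_pos hex]
    exact hex.choose_spec
  refine ⟨c, ?_, hzero⟩
  rw [Metric.tendsto_nhds]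
  intro η hη
  filter_upwards [hsign η hη, hzero] with ε hε hz
  rw [dist_zero_right, Real.norm_eq_abs, abs_lt]
  constructor
  · by_contra! hcon
    linarith [hmono ε hε.1 hcon]
  · by_contra! hcon
    linarith [hmono ε hε.1 hcon]

/-- Second variation of the `q`-norm. -/
lemma tendsto_secondDiff_norm (hp : 1 < p) (hq : 1 < q) (h : Extremal p q κ a b u u')
    {ζ c : ℝ → ℝ} (hζ : ContinuousOn ζ (Icc a b)) (hc : Tendsto c (𝓝[>] 0) (𝓝 0)) :
    Tendsto (fun ε => ∫ x in a..b, secondDiff q (u x) (ε * (ζ x + c ε)) / ε ^ 2) (𝓝[>] 0)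
      (𝓝 (q * (q - 1) * ∫ x in a..b, |u x| ^ (q - 2) * ζ x ^ 2)) := by
  have hab := h.lt.le
  obtain ⟨C, hC, hbound⟩ := abs_secondDiff_le hq
  obtain ⟨Z, hZ, hζZ⟩ := exists_bound hζ
  rw [← intervalIntegral.integral_const_mul]
  refine intervalIntegral.tendsto_integral_filter_of_dominated_convergence
    (fun x => C * (Z + 1) ^ 2 * (|u x| ^ (q - 2) + 1)) ?_ ?_ ?_ ?_
  · refine Eventually.of_forall fun ε => aestronglyMeasurable_of_continuousOn hab ?_
    exact ((continuous_secondDiff (by linarith)).comp_continuousOn (h.c1On.continuousOn.prodMk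
      (continuousOn_const.mul (hζ.add continuousOn_const)))).div_const _
  · have hsmall : ∀ᶠ ε : ℝ in 𝓝[>] 0, ε * (Z + 1) ≤ 1 := by
      have : Tendsto (fun ε : ℝ => ε * (Z + 1)) (𝓝[>] 0) (𝓝 (0 * (Z + 1))) :=
        (tendsto_nhdsWithin_of_tendsto_nhds tendsto_id).mul_const _
      rw [zero_mul] at this
      exact (this.eventually_lt_const one_pos).mono fun _ h => h.le
    filter_upwards [self_mem_nhdsWithin, hsmall, Metric.tendsto_nhds.1 hc 1 one_pos]
      with ε hε hε1 hcε
    have hε0 : 0 < ε := hε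
    filter_upwards [h.ae_ne_zero hp hq] with x hx hxI
    have hxI' : x ∈ Icc a b := by
      rw [uIoc_of_le hab] at hxI; exact Ioc_subset_Icc_self hxI
    rw [dist_zero_right, Real.norm_eq_abs] at hcε
    have h1 : |ζ x + c ε| ≤ Z + 1 :=
      (abs_add_le _ _).trans (add_le_add (hζZ x hxI') hcε.le)
    have h2 : |ε * (ζ x + c ε)| ≤ 1 := by
      rw [abs_mul, abs_of_pos hε0]
      exact (mul_le_mul_of_nonneg_left h1 hε0.le).trans hε1
    have h3 := hbound (u x) _ (hx hxI) h2
    have h4 : (ζ x + c ε) ^ 2 ≤ (Z + 1) ^ 2 := by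
      rw [← sq_abs]; gcongr
    have h5 : 0 ≤ |u x| ^ (q - 2) := Real.rpow_nonneg (abs_nonneg _) _
    rw [Real.norm_eq_abs, abs_div, abs_of_pos (by positivity : 0 < ε ^ 2),
      div_le_iff₀ (by positivity)]
    refine h3.trans ?_
    calc C * (ε * (ζ x + c ε)) ^ 2 * (|u x| ^ (q - 2) + 1)
        = C * (ζ x + c ε) ^ 2 * (|u x| ^ (q - 2) + 1) * ε ^ 2 := by ring
      _ ≤ C * (Z + 1) ^ 2 * (|u x| ^ (q - 2) + 1) * ε ^ 2 := by gcongr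
  · exact ((h.intervalIntegrable hp hq (by linarith)).add intervalIntegrable_const).const_mul _
  · filter_upwards [h.ae_ne_zero hp hq] with x hx hxI
    have := tendsto_secondDiff_div hq (hx hxI) (h := fun ε => ζ x + c ε) (h₀ := ζ x)
      (by simpa using hc.const_add (ζ x))
    rwa [mul_assoc] at this

end Extremal

/-- Second variation of the `p`-norm of the derivative. The second differences of `|·|^p` scale:
relative perturbations `ε k` of `v` enter, and no degeneracy occurs at the zeros of `v`. -/
lemma tendsto_secondDiff_energy {p a b C : ℝ} (hp : 1 < p) (hab : a ≤ b) {v k : ℝ → ℝ}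
    (hv : ContinuousOn v (Icc a b)) (hkv : ContinuousOn (fun x => k x * v x) (Icc a b))
    (hk : ∀ x ∈ Icc a b, |k x| ≤ C) :
    Tendsto (fun ε => ∫ x in a..b, secondDiff p (v x) (ε * (k x * v x)) / ε ^ 2) (𝓝[>] 0)
      (𝓝 (p * (p - 1) * ∫ x in a..b, |v x| ^ p * k x ^ 2)) := by
  have hC : 0 ≤ C := (abs_nonneg _).trans (hk a (left_mem_Icc.2 hab))
  obtain ⟨D, hD, hbound⟩ := abs_secondDiff_le hp
  have e : ∀ x ε : ℝ, secondDiff p (v x) (ε * (k x * v x)) =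
      |v x| ^ p * secondDiff p 1 (ε * k x) := fun x ε => by
    rw [← secondDiff_mul]; congr 1; ring
  rw [← intervalIntegral.integral_const_mul]
  refine intervalIntegral.tendsto_integral_filter_of_dominated_convergence
    (fun x => |v x| ^ p * (D * C ^ 2 * 2)) ?_ ?_ ?_ ?_
  · refine Eventually.of_forall fun ε => aestronglyMeasurable_of_continuousOn hab ?_
    exact ((continuous_secondDiff (by linarith)).comp_continuousOn (hv.prodMk
      (continuousOn_const.mul hkv))).div_const _
  · have hsmall : ∀ᶠ ε : ℝ in 𝓝[>] 0, ε * C ≤ 1 := by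
      have : Tendsto (fun ε : ℝ => ε * C) (𝓝[>] 0) (𝓝 (0 * C)) :=
        (tendsto_nhdsWithin_of_tendsto_nhds tendsto_id).mul_const _
      rw [zero_mul] at this
      exact (this.eventually_lt_const one_pos).mono fun _ h => h.le
    filter_upwards [self_mem_nhdsWithin, hsmall] with ε hε hε1
    have hε0 : 0 < ε := hε
    refine Eventually.of_forall fun x hx => ?_
    rw [uIoc_of_le hab] at hx
    have h1 := hk x (Ioc_subset_Icc_self hx)
    have h2 : |ε * k x| ≤ 1 := by
      rw [abs_mul, abs_of_pos hε0]
      exact (mul_le_mul_of_nonneg_left h1 hε0.le).trans hε1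
    have h3 := hbound 1 _ one_ne_zero h2
    rw [abs_one, Real.one_rpow] at h3
    have h4 : k x ^ 2 ≤ C ^ 2 := by rw [← sq_abs]; gcongr
    rw [e, Real.norm_eq_abs, abs_div, abs_mul, abs_of_pos (by positivity : 0 < ε ^ 2),
      div_le_iff₀ (by positivity), abs_of_nonneg (Real.rpow_nonneg (abs_nonneg (v x)) p), mul_assoc]
    refine mul_le_mul_of_nonneg_left ?_ (Real.rpow_nonneg (abs_nonneg (v x)) p)
    calc |secondDiff p 1 (ε * k x)| ≤ D * (ε * k x) ^ 2 * (1 + 1) := h3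
      _ = D * k x ^ 2 * 2 * ε ^ 2 := by ring
      _ ≤ D * C ^ 2 * 2 * ε ^ 2 := by gcongr
  · exact ((hv.abs.rpow_const fun _ _ => Or.inr (by linarith)).mul
      continuousOn_const).intervalIntegrable_of_Icc hab
  · refine Eventually.of_forall fun x _ => ?_
    have := (tendsto_secondDiff_div hp one_ne_zero (h := fun _ => k x)
      (h₀ := k x) tendsto_const_nhds).const_mul (|v x| ^ p)
    rw [abs_one, Real.one_rpow] at this
    refine (this.congr fun ε => ?_).trans (le_of_eq ?_)
    · rw [e, mul_div_assoc]
    · congr 1; ring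

/-- A perturbation of opposite parity contributes to the integral of `|·|^s` through symmetric
second differences only. -/
lemma integral_abs_add_rpow {a b s : ℝ} (hab : a ≤ b) (hs : 1 < s) {f g : ℝ → ℝ}
    (hf : ContinuousOn f (Icc a b)) (hg : ContinuousOn g (Icc a b))
    (hfg : ∀ x ∈ Icc a b, |f (a + b - x) + g (a + b - x)| = |f x - g x|) :
    ∫ x in a..b, |f x + g x| ^ s =
      (∫ x in a..b, |f x| ^ s) + 1 / 2 * ∫ x in a..b, secondDiff s (f x) (g x) := by
  have hpow : ∀ {k : ℝ → ℝ}, ContinuousOn k (Icc a b) →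
      IntervalIntegrable (fun x => |k x| ^ s) MeasureTheory.volume a b := fun hk =>
    (hk.abs.rpow_const fun _ _ => Or.inr (by linarith)).intervalIntegrable_of_Icc hab
  have h1 : ∫ x in a..b, |f x + g x| ^ s = ∫ x in a..b, |f x - g x| ^ s := by
    rw [← integral_reflect]
    exact intervalIntegral.integral_congr fun x hx => by
      rw [uIcc_of_le hab] at hx
      simp only [hfg x hx]
  have i1 : IntervalIntegrable (fun x => |f x + g x| ^ s) MeasureTheory.volume a b :=
    hpow (hf.add hg)
  have i2 : IntervalIntegrable (fun x => |f x - g x| ^ s) MeasureTheory.volume a b :=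
    hpow (hf.sub hg)
  simp only [secondDiff]
  rw [intervalIntegral.integral_sub (i1.add i2) ((hpow hf).const_mul 2),
    intervalIntegral.integral_add i1 i2, intervalIntegral.integral_const_mul]
  linarith

/-- Above the threshold there is no odd local minimizer: after normalization it would be an
`Extremal`, and the even direction of `Extremal.exists_negative_direction` decreases the ratio. -/
theorem not_oddMin {p q r a b : ℝ} {u₀ u₀' : ℝ → ℝ} (hp : 1 < p) (hq : 1 < q) (hr : 1 < r)
    (hpqr : (2 * r - 1) * p < q) : ¬ OddMin p q r a b u₀ u₀' := by
  intro h₀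
  obtain ⟨u, u', hmin, h⟩ := h₀.exists_extremal hp hq
  have hE := hmin.energy_pos hp
  have hN := hmin.norm_pos hq
  set E := ∫ x in a..b, |u' x| ^ p with hEdef
  set N := ∫ x in a..b, |u x| ^ q with hNdef
  have hab := h.lt.le
  have hu := h.c1On.continuousOn
  have hu' := h.c1On.continuousOn_deriv
  obtain ⟨ζ, k, C, hζ, hζeven, hk, htan, hneg⟩ :=
    h.exists_negative_direction hp hq hr hpqr hmin.odd
  have h0 : ∫ x in a..b, spow r (u x) = 0 := integral_eq_zero_of_odd hab fun x hx => by
    rw [hmin.odd x hx, spow_neg]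
  obtain ⟨c, hc, hcz⟩ := h.exists_correction hp hq hr h0 hζ.continuousOn htan
  have hkodd : ∀ x ∈ Icc a b, k (a + b - x) * u' (a + b - x) = -(k x * u' x) := fun x hx => by
    have := hζ.deriv_reflect (σ := 1) h.lt (fun y hy => by rw [hζeven y hy, one_mul]) hx
    linarith
  set e : ℝ → ℝ := fun ε => ∫ x in a..b, secondDiff p (u' x) (ε * (k x * u' x)) / ε ^ 2 with he
  set n : ℝ → ℝ := fun ε => ∫ x in a..b, secondDiff q (u x) (ε * (ζ x + c ε)) / ε ^ 2 with hn
  have hlime : Tendsto e _ _ := tendsto_secondDiff_energy hp hab hu' hζ.continuousOn_deriv hk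
  have hlimn : Tendsto n _ _ := h.tendsto_secondDiff_norm hp hq hζ.continuousOn hc
  have hEε : ∀ ε : ℝ, 0 < ε → ∫ x in a..b, |u' x + ε * (k x * u' x)| ^ p =
      E + ε ^ 2 * (1 / 2 * e ε) := fun ε hε => by
    rw [integral_abs_add_rpow (g := fun x => ε * (k x * u' x)) hab hp hu'
      (continuousOn_const.mul hζ.continuousOn_deriv) ?_]
    · simp only [he]
      rw [← hEdef, intervalIntegral.integral_div]
      field_simp
    · intro x hx
      rw [hkodd x hx, hmin.deriv_even x hx, mul_neg, sub_eq_add_neg]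
  have hNε : ∀ ε : ℝ, 0 < ε → ∫ x in a..b, |u x + ε * (ζ x + c ε)| ^ q =
      N + ε ^ 2 * (1 / 2 * n ε) := fun ε hε => by
    rw [integral_abs_add_rpow (g := fun x => ε * (ζ x + c ε)) hab hq hu
      (continuousOn_const.mul (hζ.continuousOn.add continuousOn_const)) ?_]
    · simp only [hn]
      rw [← hNdef, intervalIntegral.integral_div]
      field_simp
    · intro x hx
      rw [hmin.odd x hx, hζeven x hx, ← abs_neg]
      congr 1
      ring
  have hid : Tendsto (fun ε : ℝ => ε) (𝓝[>] 0) (𝓝 0) :=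
    tendsto_nhdsWithin_of_tendsto_nhds tendsto_id
  have hEto : Tendsto (fun ε => E + ε ^ 2 * (1 / 2 * e ε)) (𝓝[>] 0) (𝓝 E) := by
    simpa only [zero_pow two_ne_zero, zero_mul, add_zero] using
      ((hid.pow 2).mul (hlime.const_mul (1 / 2))).const_add E
  have hNto : Tendsto (fun ε => N + ε ^ 2 * (1 / 2 * n ε)) (𝓝[>] 0) (𝓝 N) := by
    simpa only [zero_pow two_ne_zero, zero_mul, add_zero] using
      ((hid.pow 2).mul (hlimn.const_mul (1 / 2))).const_add N
  obtain ⟨δ, hδ, hratio⟩ := hmin.isMin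
  obtain ⟨Z, hZ, hζZ⟩ := exists_bound hζ.continuousOn
  have hsmall : ∀ᶠ ε : ℝ in 𝓝[>] 0, ε * (Z + 1) ≤ δ := by
    have := hid.mul_const (Z + 1)
    rw [zero_mul] at this
    exact (this.eventually_lt_const hδ).mono fun _ h => h.le
  -- `log x ≤ x - 1` turns minimality into an inequality between second differences
  have hineq : ∀ᶠ ε in 𝓝[>] 0, 0 ≤ 1 / p * ((1 / 2 * e ε) / E) -
      1 / q * ((1 / 2 * n ε) / (N + ε ^ 2 * (1 / 2 * n ε))) := by
    filter_upwards [self_mem_nhdsWithin, hcz, hsmall, Metric.tendsto_nhds.1 hc 1 one_pos,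
      (eventually_abs_mul_le hδ hζ.continuousOn_deriv).filter_mono nhdsWithin_le_nhds,
      hEto.eventually_const_lt hE, hNto.eventually_const_lt hN]
      with ε hε hcz hε1 hcε hε2 hEpos hNpos
    have hε0 : 0 < ε := hε
    rw [dist_zero_right, Real.norm_eq_abs] at hcε
    have hw : C1On a b (fun x => ε * (ζ x + c ε)) (fun x => ε * (k x * u' x)) := by
      have := (hζ.add (C1On.const a b (c ε))).const_mul ε
      simpa using this
    have hle := hratio _ _ hw (fun x hx => by
      rw [abs_mul, abs_of_pos hε0]
      refine le_trans ?_ hε1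
      gcongr
      exact (abs_add_le _ _).trans (add_le_add (hζZ x hx) hcε.le)) hε2 hcz
    rw [ratio, ratio, hEε ε hε0, hNε ε hε0, ratio_le_ratio_iff hE hN hEpos hNpos] at hle
    set E' := E + ε ^ 2 * (1 / 2 * e ε) with hE'
    set N' := N + ε ^ 2 * (1 / 2 * n ε) with hN'
    have l1 : Real.log E' - Real.log E ≤ ε ^ 2 * ((1 / 2 * e ε) / E) := by
      rw [← Real.log_div hEpos.ne' hE.ne']
      refine (Real.log_le_sub_one_of_pos (div_pos hEpos hE)).trans (le_of_eq ?_)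
      rw [hE']; field_simp; ring
    have l2 : Real.log N - Real.log N' ≤ -(ε ^ 2 * ((1 / 2 * n ε) / N')) := by
      rw [← Real.log_div hN.ne' hNpos.ne']
      refine (Real.log_le_sub_one_of_pos (div_pos hN hNpos)).trans (le_of_eq ?_)
      rw [eq_comm, neg_eq_iff_eq_neg, ← mul_div_assoc, div_eq_iff hNpos.ne', neg_sub, sub_mul,
        div_mul_cancel₀ _ hNpos.ne', hN']
      ring
    have hp' : 0 < 1 / p := by positivity
    have hq' : 0 < 1 / q := by positivity
    have l3 := mul_le_mul_of_nonneg_left l1 hp'.le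
    have l4 := mul_le_mul_of_nonneg_left l2 hq'.le
    refine nonneg_of_mul_nonneg_right (a := ε ^ 2) ?_ (by positivity)
    linarith
  have hlim := ((hlime.const_mul (1 / 2)).div_const E).const_mul (1 / p) |>.sub
    (((hlimn.const_mul (1 / 2)).div hNto hN.ne').const_mul (1 / q))
  have hge := ge_of_tendsto hlim hineq
  set P := ∫ x in a..b, |u' x| ^ p * k x ^ 2
  set R := ∫ x in a..b, |u x| ^ (q - 2) * ζ x ^ 2
  have hp0 : p ≠ 0 := by linarith
  have hq0 : q ≠ 0 := by linarith
  have e1 : 1 / p * (1 / 2 * (p * (p - 1) * P) / E) - 1 / q * (1 / 2 * (q * (q - 1) * R) / N) =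
      1 / (2 * E) * ((p - 1) * P - E / N * ((q - 1) * R)) := by
    field_simp
  rw [e1] at hge
  have : 1 / (2 * E) * ((p - 1) * P - E / N * ((q - 1) * R)) < 0 :=
    mul_neg_of_pos_of_neg (by positivity) (by linarith)
  linarith

/-! ### The function `u_W` -/

/-- The inverse function of `u_W`: the primitive of `(1 - |t|^q)^(-1/p)` vanishing at `0`. -/
def invUW (p q y : ℝ) : ℝ := ∫ t in 0..y, (1 - |t| ^ q) ^ (-(1 / p))

section InvUW

variable {p q : ℝ}

lemma intervalIntegrable_invUW (hp : 1 < p) (hq : 1 < q) {y z : ℝ} (hy : y ∈ Icc (-1 : ℝ) 1)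
    (hz : z ∈ Icc (-1 : ℝ) 1) :
    IntervalIntegrable (fun t : ℝ => (1 - |t| ^ q) ^ (-(1 / p))) MeasureTheory.volume y z := by
  have hpinv : 1 / p < 1 := by rw [div_lt_one (by linarith)]; exact hp
  have hpinv0 : 0 < 1 / p := by positivity
  have hmeas : Measurable fun t : ℝ => (1 - |t| ^ q) ^ (-(1 / p)) :=
    (measurable_const.sub (measurable_id.abs.pow_const q)).pow_const _
  refine ((intervalIntegrable_one_sub_abs_rpow (by linarith : -1 < -(1 / p)) hy hz).const_mul
    1).mono_fun' hmeas.aestronglyMeasurable ?_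
  refine (MeasureTheory.ae_restrict_iff' measurableSet_uIoc).2 (Eventually.of_forall fun t ht => ?_)
  have ht1 : |t| ≤ 1 := abs_le.2 (uIcc_subset_Icc hy hz (uIoc_subset_uIcc ht))
  have h1 := abs_rpow_le_self hq ht1
  simp only [one_mul]
  rcases ht1.eq_or_lt with h | h
  · rw [h, Real.one_rpow, sub_self, Real.zero_rpow (by linarith), norm_zero]
  · rw [Real.norm_eq_abs, abs_of_nonneg (Real.rpow_nonneg (by linarith) _)]
    exact Real.rpow_le_rpow_of_nonpos (by linarith) (by linarith) (by linarith)

lemma invUW_neg (p q y : ℝ) : invUW p q (-y) = -invUW p q y := by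
  have := intervalIntegral.integral_comp_neg (a := 0) (b := y)
    (fun t : ℝ => (1 - |t| ^ q) ^ (-(1 / p)))
  simp only [abs_neg, neg_zero] at this
  rw [invUW, invUW, this, intervalIntegral.integral_symm]

lemma invUW_sub (hp : 1 < p) (hq : 1 < q) {y z : ℝ} (hy : y ∈ Icc (-1 : ℝ) 1)
    (hz : z ∈ Icc (-1 : ℝ) 1) :
    invUW p q z - invUW p q y = ∫ t in y..z, (1 - |t| ^ q) ^ (-(1 / p)) := by
  have h0 : (0 : ℝ) ∈ Icc (-1 : ℝ) 1 := by constructor <;> norm_num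
  exact intervalIntegral.integral_interval_sub_left (intervalIntegrable_invUW hp hq h0 hz)
    (intervalIntegrable_invUW hp hq h0 hy)

/-- The integrand is at least `1` on `(-1, 1)`. -/
lemma sub_le_invUW_sub (hp : 1 < p) (hq : 1 < q) {y z : ℝ} (hy : y ∈ Icc (-1 : ℝ) 1)
    (hz : z ∈ Icc (-1 : ℝ) 1) (hyz : y ≤ z) : z - y ≤ invUW p q z - invUW p q y := by
  have h1 : ∫ _ in y..z, (1 : ℝ) = z - y := by simp
  rw [invUW_sub hp hq hy hz, ← h1]
  refine intervalIntegral.integral_mono_on_of_le_Ioo hyz (by simp)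
    (intervalIntegrable_invUW hp hq hy hz) fun t ht => ?_
  have ht1 : |t| < 1 := abs_lt.2 ⟨by linarith [ht.1, hy.1], by linarith [ht.2, hz.2]⟩
  have hpinv : 0 ≤ 1 / p := by positivity
  refine Real.one_le_rpow_of_pos_of_le_one_of_nonpos (one_sub_abs_rpow_pos hq ht1) ?_ (by linarith)
  linarith [Real.rpow_nonneg (abs_nonneg t) q]

lemma strictMonoOn_invUW (hp : 1 < p) (hq : 1 < q) :
    StrictMonoOn (invUW p q) (Icc (-1) 1) := fun y hy z hz hyz => by
  linarith [sub_le_invUW_sub hp hq hy hz hyz.le]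

lemma continuousOn_invUW (hp : 1 < p) (hq : 1 < q) :
    ContinuousOn (invUW p q) (Icc (-1) 1) := by
  have h := intervalIntegrable_invUW hp hq (left_mem_Icc.2 (by norm_num : (-1 : ℝ) ≤ 1))
    (right_mem_Icc.2 (by norm_num))
  have := intervalIntegral.continuousOn_primitive_interval' h
    (by rw [uIcc_of_le (by norm_num : (-1 : ℝ) ≤ 1)]; constructor <;> norm_num :
      (0 : ℝ) ∈ uIcc (-1) 1)
  rwa [uIcc_of_le (by norm_num : (-1 : ℝ) ≤ 1)] at this

lemma hasDerivAt_invUW (hp : 1 < p) (hq : 1 < q) {y : ℝ} (hy : |y| < 1) :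
    HasDerivAt (invUW p q) ((1 - |y| ^ q) ^ (-(1 / p))) y := by
  have hm : y ∈ Icc (-1 : ℝ) 1 := abs_le.1 hy.le
  have hmeas : Measurable fun t : ℝ => (1 - |t| ^ q) ^ (-(1 / p)) :=
    (measurable_const.sub (measurable_id.abs.pow_const q)).pow_const _
  exact intervalIntegral.integral_hasDerivAt_right
    (intervalIntegrable_invUW hp hq (by constructor <;> norm_num) hm)
    hmeas.stronglyMeasurable.stronglyMeasurableAtFilter
    ((continuousAt_const.sub (hasDerivAt_abs_rpow_spow hq y).continuousAt).rpow_const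
      (Or.inl (one_sub_abs_rpow_pos hq hy).ne'))

lemma invUW_one_pos (hp : 1 < p) (hq : 1 < q) : 0 < invUW p q 1 := by
  have h0 : invUW p q 0 = 0 := by simp [invUW]
  have := sub_le_invUW_sub hp hq (y := 0) (z := 1) (by constructor <;> norm_num)
    (by constructor <;> norm_num) (by norm_num)
  linarith

end InvUW

lemma IsUW.c1On {p q T : ℝ} {v : ℝ → ℝ} (hp : 1 < p) (hq : 1 < q) (h : IsUW p q T v) :
    C1On (-T) T v fun x => (1 - |v x| ^ q) ^ (1 / p) := by
  have hc : ContinuousOn v (Icc (-T) T) := fun x hx => (h.hasDerivWithinAt x hx).continuousWithinAt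
  refine ⟨?_, h.hasDerivWithinAt⟩
  have hpinv : 0 ≤ 1 / p := by positivity
  exact (continuousOn_const.sub (hc.abs.rpow_const fun _ _ => Or.inr (by linarith))).rpow_const
    fun _ _ => Or.inr hpinv

/-- Separation of variables. -/
lemma IsUW.eq_inverse {p q T : ℝ} {v : ℝ → ℝ} (hp : 1 < p) (hq : 1 < q) (h : IsUW p q T v) :
    T = invUW p q 1 ∧ ∀ x ∈ Icc (-T) T, v x ∈ Icc (-1 : ℝ) 1 ∧ invUW p q (v x) = x := by
  have hlt : -T < T := by linarith [h.pos]
  have hv := h.c1On hp hq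
  have hpinv : 0 < 1 / p := by positivity
  have hmaps : ∀ x ∈ Icc (-T) T, v x ∈ Icc (-1 : ℝ) 1 := fun x hx => abs_le.1 (h.abs_le_one x hx)
  have hend : ∀ x ∈ Icc (-T) T, der (-T) T v x = 0 → |v x| = 1 := fun x hx h0 => by
    rw [hv.der_eq hlt hx] at h0
    have h1 : |v x| ^ q ≤ 1 := Real.rpow_le_one (abs_nonneg _) (h.abs_le_one x hx) (by linarith)
    have h2 := (Real.rpow_eq_zero (by linarith) hpinv.ne').1 h0
    exact (Real.rpow_left_inj (abs_nonneg _) zero_le_one (by linarith : q ≠ 0)).1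
      (by rw [Real.one_rpow]; linarith)
  have hin : ∀ x ∈ Ioo (-T) T, |v x| < 1 := fun x hx => by
    have hxI := Ioo_subset_Icc_self hx
    refine lt_of_le_of_ne (h.abs_le_one x hxI) fun h1 => ?_
    have := h.der_pos x hx
    rw [hv.der_eq hlt hxI, h1, Real.one_rpow, sub_self, Real.zero_rpow hpinv.ne'] at this
    exact lt_irrefl _ this
  have hXv : ContinuousOn (fun x => invUW p q (v x)) (Icc (-T) T) :=
    (continuousOn_invUW hp hq).comp hv.continuousOn hmaps
  have hd : ∀ x ∈ Ioo (-T) T, HasDerivAt (fun x => invUW p q (v x)) 1 x := fun x hx => by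
    refine ((hasDerivAt_invUW hp hq (hin x hx)).comp x (hv.hasDerivAt hx)).congr_deriv ?_
    have := one_sub_abs_rpow_pos hq (hin x hx)
    rw [Real.rpow_neg this.le, inv_mul_cancel₀ (Real.rpow_pos_of_pos this _).ne']
  have key : ∀ x ∈ Icc (-T) T, invUW p q (v x) - invUW p q (v (-T)) = x + T := fun x hx => by
    rw [← intervalIntegral.integral_eq_sub_of_hasDerivAt_of_le hx.1
      (hXv.mono (Icc_subset_Icc_right hx.2)) (fun y hy => hd y ⟨hy.1, hy.2.trans_le hx.2⟩)
      intervalIntegrable_const]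
    simp
  have hl := left_mem_Icc.2 hlt.le
  have hr := right_mem_Icc.2 hlt.le
  have hT := key T hr
  have hmono : v (-T) < v T := by
    rw [← (strictMonoOn_invUW hp hq).lt_iff_lt (hmaps _ hl) (hmaps _ hr)]
    linarith [h.pos]
  have hvT : v T = 1 := by
    have h1 := hend _ hr h.der_right
    have h2 := hend _ hl h.der_left
    rcases eq_or_eq_neg_of_abs_eq h1 with h1 | h1
    · exact h1
    · rcases eq_or_eq_neg_of_abs_eq h2 with h2 | h2 <;> linarith
  have hvT' : v (-T) = -1 := by
    rcases eq_or_eq_neg_of_abs_eq (hend _ hl h.der_left) with h2 | h2 <;> linarith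
  rw [hvT, hvT', invUW_neg] at hT
  have hTeq : T = invUW p q 1 := by linarith
  refine ⟨hTeq, fun x hx => ⟨hmaps x hx, ?_⟩⟩
  have := key x hx
  rw [hvT', invUW_neg, ← hTeq] at this
  linarith

lemma exists_isUW {p q : ℝ} (hp : 1 < p) (hq : 1 < q) : ∃ u, IsUW p q (invUW p q 1) u := by
  set T := invUW p q 1 with hT
  have hT0 : 0 < T := invUW_one_pos hp hq
  have hlt : -T < T := by linarith
  have hpinv : 0 < 1 / p := by positivity
  have hm1 : (1 : ℝ) ∈ Icc (-1 : ℝ) 1 := by constructor <;> norm_num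
  have hm1' : (-1 : ℝ) ∈ Icc (-1 : ℝ) 1 := by constructor <;> norm_num
  have hinj := (strictMonoOn_invUW hp hq).injOn
  have hsurj : SurjOn (invUW p q) (Icc (-1) 1) (Icc (-T) T) := by
    have := intermediate_value_Icc (by norm_num : (-1 : ℝ) ≤ 1) (continuousOn_invUW hp hq)
    rwa [invUW_neg] at this
  set u : ℝ → ℝ := Function.invFunOn (invUW p q) (Icc (-1) 1) with hu
  have hmem : ∀ x ∈ Icc (-T) T, u x ∈ Icc (-1 : ℝ) 1 := fun x hx =>
    Function.invFunOn_mem (hsurj hx)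
  have hXu : ∀ x ∈ Icc (-T) T, invUW p q (u x) = x := fun x hx =>
    Function.invFunOn_eq (hsurj hx)
  have huT : u T = 1 := hinj (hmem T (right_mem_Icc.2 hlt.le)) hm1 (hXu T (right_mem_Icc.2 hlt.le))
  have huT' : u (-T) = -1 := hinj (hmem _ (left_mem_Icc.2 hlt.le)) hm1' (by
    rw [hXu _ (left_mem_Icc.2 hlt.le), invUW_neg])
  have hin : ∀ x ∈ Ioo (-T) T, |u x| < 1 := fun x hx => by
    have hxI := Ioo_subset_Icc_self hx
    refine lt_of_le_of_ne (abs_le.2 (hmem x hxI)) fun h1 => ?_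
    have hX := hXu x hxI
    rcases eq_or_eq_neg_of_abs_eq h1 with h | h
    · rw [h] at hX; linarith [hx.2]
    · rw [h, invUW_neg] at hX; linarith [hx.1]
  -- the inverse function is 1-Lipschitz, because its inverse expands
  have hucont : ContinuousOn u (Icc (-T) T) := by
    have hlip : LipschitzOnWith 1 u (Icc (-T) T) := by
      refine LipschitzOnWith.of_dist_le_mul fun x hx y hy => ?_
      rw [NNReal.coe_one, one_mul, Real.dist_eq, Real.dist_eq]
      rcases le_total (u x) (u y) with h | h
      · have := sub_le_invUW_sub hp hq (hmem x hx) (hmem y hy) h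
        rw [hXu x hx, hXu y hy] at this
        rw [abs_sub_comm, abs_of_nonneg (by linarith), abs_sub_comm]
        exact this.trans (le_abs_self _)
      · have := sub_le_invUW_sub hp hq (hmem y hy) (hmem x hx) h
        rw [hXu x hx, hXu y hy] at this
        rw [abs_of_nonneg (by linarith)]
        exact this.trans (le_abs_self _)
    exact hlip.continuousOn
  have hd : ∀ x ∈ Ioo (-T) T, HasDerivAt u ((1 - |u x| ^ q) ^ (1 / p)) x := fun x hx => by
    have hpos := one_sub_abs_rpow_pos hq (hin x hx)
    have hnhds := Icc_mem_nhds hx.1 hx.2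
    have := HasDerivAt.of_local_left_inverse
      ((hucont x (Ioo_subset_Icc_self hx)).continuousAt hnhds)
      (hasDerivAt_invUW hp hq (hin x hx)) (Real.rpow_pos_of_pos hpos _).ne'
      (by filter_upwards [hnhds] with y hy using hXu y hy)
    refine this.congr_deriv ?_
    rw [Real.rpow_neg hpos.le, inv_inv]
  have hdc : ContinuousOn (fun x => (1 - |u x| ^ q) ^ (1 / p)) (Icc (-T) T) :=
    (continuousOn_const.sub (hucont.abs.rpow_const fun _ _ => Or.inr (by linarith))).rpow_const
      fun _ _ => Or.inr hpinv.le
  -- recovering `u` as a primitive also gives the one-sided derivatives at the endpoints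
  have hC1 : C1On (-T) T u fun x => (1 - |u x| ^ q) ^ (1 / p) := by
    have hprim := (C1On.primitive (left_mem_Icc.2 hlt.le) hdc).add (C1On.const (-T) T (u (-T)))
    have heq : ∀ x ∈ Icc (-T) T,
        u x = (∫ t in (-T)..x, (1 - |u t| ^ q) ^ (1 / p)) + u (-T) := fun x hx => by
      rw [intervalIntegral.integral_eq_sub_of_hasDerivAt_of_le hx.1
        (hucont.mono (Icc_subset_Icc_right hx.2)) (fun y hy => hd y ⟨hy.1, hy.2.trans_le hx.2⟩)
        ((hdc.mono (Icc_subset_Icc_right hx.2)).intervalIntegrable_of_Icc hx.1)]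
      ring
    refine ⟨hdc, fun x hx => ?_⟩
    have := (hprim.2 x hx).congr heq (heq x hx)
    simpa using this
  refine ⟨u, hT0, fun x hx => abs_le.2 (hmem x hx), hC1.2, ?_, ?_, ?_⟩
  · rw [hC1.der_eq hlt (left_mem_Icc.2 hlt.le), huT']
    simp [show p ≠ 0 by linarith]
  · rw [hC1.der_eq hlt (right_mem_Icc.2 hlt.le), huT]
    simp [show p ≠ 0 by linarith]
  · intro x hx
    rw [hC1.der_eq hlt (Ioo_subset_Icc_self hx)]
    exact Real.rpow_pos_of_pos (one_sub_abs_rpow_pos hq (hin x hx)) _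

lemma IsUW.unique {p q T T' : ℝ} {u v : ℝ → ℝ} (hp : 1 < p) (hq : 1 < q) (hu : IsUW p q T u)
    (hv : IsUW p q T' v) : T' = T ∧ EqOn v u (Icc (-T) T) := by
  obtain ⟨h1, h2⟩ := hu.eq_inverse hp hq
  obtain ⟨h3, h4⟩ := hv.eq_inverse hp hq
  have hT : T' = T := h3.trans h1.symm
  subst hT
  refine ⟨rfl, fun x hx => (strictMonoOn_invUW hp hq).injOn (h4 x hx).1 (h2 x hx).1 ?_⟩
  rw [(h4 x hx).2, (h2 x hx).2]

lemma IsUW.isOddOn {p q T : ℝ} {u : ℝ → ℝ} (hp : 1 < p) (hq : 1 < q) (hu : IsUW p q T u) :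
    IsOddOn (-T) T u := by
  intro x hx
  obtain ⟨-, h⟩ := hu.eq_inverse hp hq
  have hx' := reflect_mem hx
  have hm := (h x hx).1
  refine (strictMonoOn_invUW hp hq).injOn (h _ hx').1 ⟨by linarith [hm.2], by linarith [hm.1]⟩ ?_
  rw [(h _ hx').2, invUW_neg, (h x hx).2]
  ring

lemma IsUW.admissible {p q T : ℝ} {u : ℝ → ℝ} (hp : 1 < p) (hq : 1 < q) (hu : IsUW p q T u)
    (r : ℝ) : Admissible r (-T) T u := by
  have hlt : -T < T := by linarith [hu.pos]
  refine ⟨(hu.c1On hp hq).contDiffOn hlt, ⟨T, right_mem_Icc.2 hlt.le, fun h0 => ?_⟩,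
    integral_eq_zero_of_odd hlt.le fun x hx => ?_⟩
  · obtain ⟨hT, h⟩ := hu.eq_inverse hp hq
    have := (h T (right_mem_Icc.2 hlt.le)).2
    rw [h0] at this
    have h1 := hu.pos
    simp [invUW] at this
    linarith
  · rw [hu.isOddOn hp hq x hx, abs_neg, mul_neg]

theorem not_isLocalMinimizer_of_isOddOn {p q r a b : ℝ} {u : ℝ → ℝ} (hp : 1 < p) (hq : 1 < q)
    (hr : 1 < r) (hpqr : (2 * r - 1) * p < q) (hab : a < b) (hodd : IsOddOn a b u) :
    ¬ IsLocalMinimizer p q r a b u := fun h =>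
  not_oddMin hp hq hr hpqr (OddMin.of_isLocalMinimizer hab hodd h)

end Wirtinger

end

theorem mainTheorem2 (p q r : ℝ) (hp : 1 < p) (hq : 1 < q) (hr : 1 < r)
    (hpqr : (2 * r - 1) * p < q) :
    (∃ (T : ℝ) (uW : ℝ → ℝ), Wirtinger.IsUW p q T uW ∧
      (∀ (T' : ℝ) (u : ℝ → ℝ), Wirtinger.IsUW p q T' u →
        T' = T ∧ Set.EqOn u uW (Set.Icc (-T) T)) ∧
      Wirtinger.IsOddOn (-T) T uW ∧
      Wirtinger.Admissible r (-T) T uW ∧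
      ¬ Wirtinger.IsLocalMinimizer p q r (-T) T uW) ∧
    (∀ (a b : ℝ) (u : ℝ → ℝ), a < b → Wirtinger.IsOddOn a b u →
      ¬ Wirtinger.IsLocalMinimizer p q r a b u) := by
  obtain ⟨uW, hW⟩ := Wirtinger.exists_isUW hp hq
  exact ⟨⟨_, uW, hW, fun _ _ hu => hW.unique hp hq hu, hW.isOddOn hp hq, hW.admissible hp hq r,
    Wirtinger.not_isLocalMinimizer_of_isOddOn hp hq hr hpqr (by linarith [hW.pos])
      (hW.isOddOn hp hq)⟩,
    fun _ _ _ hab hodd => Wirtinger.not_isLocalMinimizer_of_isOddOn hp hq hr hpqr hab hodd⟩
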